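/- Let $\mathcal T$ be a finite rooted tree with nonnegative edge lengths, regarded as the set of its nodes together with all points on its edges (edges of length $0$ being collapsed), and equipped with the tree metric $d_{\mathcal T}$, where $d_{\mathcal T}(x,y)$ is the length of the unique path from $x$ to $y$. Let $\mathcal M(\mathcal T)$ be the set of finite nonnegative Borel measures on $\mathcal T$. Let $b\ge 0$, $\lambda\ge 0$, and let $w_1,w_2:\mathcal T\to(0,\infty)$ be $b$-Lipschitz with respect to $d_{\mathcal T}$. For $\mu,\nu\in\mathcal M(\mathcal T)$ let $\Pi_{\le}(\mu,\nu)$ be the set of finite nonnegative Borel measures $\gamma$ on $\mathcal T\times\mathcal T$ whose marginals satisfy $\gamma_1\le\mu$, $\gamma_2\le\nu$; write $\gamma_1=f_1\mu$, $\gamma_2=f_2\nu$ and set $$\mathrm{ET}_\lambda(\mu,\nu)=\inf_{\gamma\in\Pi_{\le}(\mu,\nu)}\Big[\int_{\mathcal T} w_1|f_1-1|\,d\mu+\int_{\mathcal T} w_2|f_2-1|\,d\nu+b\int_{\mathcal T\times\mathcal T}\big(d_{\mathcal T}(x,y)-\lambda\big)\,\gamma(dx,dy)\Big],$$ $$d(\mu,\nu)=\mathrm{ET}_\lambda(\mu,\nu)+\tfrac{b\lambda}{2}\big[\mu(\mathcal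 T)+\nu(\mathcal T)\big].$$ Then the following hold. (i) $d(\mu+\sigma,\nu+\sigma)=d(\mu,\nu)$ for all $\mu,\nu,\sigma\in\mathcal M(\mathcal T)$. (ii) $d(\mu,\nu)\le d(\mu,\sigma)+d(\sigma,\nu)$ for all $\mu,\nu,\sigma\in\mathcal M(\mathcal T)$. If $b>0$, then $d$ is a divergence: $d(\mu,\nu)\ge 0$, with equality if and only if $\mu=\nu$. (iii) If $b>0$ and $w_1=w_2$, then $(\mathcal M(\mathcal T),d)$ is a complete metric space. Moreover it is geodesic: for all $\mu,\nu\in\mathcal M(\mathcal T)$, with $a=d(\mu,\nu)$, there is a path $\varphi:[0,a]\to\mathcal M(\mathcal T)$ with $\varphi(0)=\mu$, $\varphi(a)=\nu$ and $d(\varphi(t),\varphi(s))=|t-s|$ for all $t,s\in[0,a]$. -/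

import Mathlib

open MeasureTheory
open scoped NNReal

noncomputable section

/-- A tree with node set `V`, rooted at `root`, with nonnegative edge lengths
(only the values of `length` at the edges of `graph` are ever used). -/
structure WeightedTree (V : Type*) where
  graph : SimpleGraph V
  isTree : graph.IsTree
  root : V
  length : Sym2 V → ℝ≥0

namespace WeightedTree

/-- The unique path between two nodes of the tree. -/
def path {V : Type*} (𝒯 : WeightedTree V) (u v : V) : 𝒯.graph.Walk u v :=
  (𝒯.isTree.existsUnique_path u v).choose

theorem path_isPath {V : Type*} (𝒯 : WeightedTree V) (u v : V) : (𝒯.path u v).IsPath :=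
  (𝒯.isTree.existsUnique_path u v).choose_spec.1

theorem eq_path {V : Type*} (𝒯 : WeightedTree V) {u v : V} (p : 𝒯.graph.Walk u v)
    (hp : p.IsPath) : p = 𝒯.path u v :=
  (𝒯.isTree.existsUnique_path u v).choose_spec.2 p hp

variable {V : Type*} [Fintype V] [DecidableEq V]

set_option linter.unusedSectionVars false

/-- The nodes are placed in the vector space of real functions on the edges, with the `ℓ¹` norm:
the node `v` is the function equal to the length of `e` at every edge `e` of the path
from the root to `v`, and to `0` elsewhere. With this placement the `ℓ¹` distance between points
of the tree is the length of the path joining them, see `dist_node`, `dist_edge`, `dist_gate`. -/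
def node (𝒯 : WeightedTree V) (v : V) : PiLp 1 (fun _ : Sym2 V => ℝ) :=
  WithLp.toLp 1 fun e => if e ∈ (𝒯.path 𝒯.root v).edges then (𝒯.length e : ℝ) else 0

/-- The set of all nodes together with all points on the edges. -/
def carrier (𝒯 : WeightedTree V) : Set (PiLp 1 (fun _ : Sym2 V => ℝ)) :=
  {x | (∃ v, x = 𝒯.node v) ∨ ∃ u v, 𝒯.graph.Adj u v ∧ x ∈ segment ℝ (𝒯.node u) (𝒯.node v)}

/-- The tree as a space of points, with the tree metric (inherited from the `ℓ¹` distance) and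
its Borel σ-algebra. Edges of length `0` are collapsed to points. -/
abbrev Point (𝒯 : WeightedTree V) : Type _ := ↥𝒯.carrier

theorem dist_eq_sum (x y : PiLp 1 (fun _ : Sym2 V => ℝ)) : dist x y = ∑ e, |x e - y e| := by
  rw [PiLp.dist_eq_of_L1]
  simp [Real.dist_eq]

theorem node_of_mem (𝒯 : WeightedTree V) {u v : V} (h : 𝒯.graph.Adj u v)
    (hv : v ∈ (𝒯.path 𝒯.root u).support) (e : Sym2 V) :
    |𝒯.node u e - 𝒯.node v e| = if e = s(u, v) then (𝒯.length e : ℝ) else 0 := by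
  set p := 𝒯.path 𝒯.root u with hp
  have hpp : p.IsPath := 𝒯.path_isPath _ _
  have h1 := 𝒯.eq_path _ (hpp.takeUntil hv)
  have h2 : p.dropUntil v hv = h.symm.toWalk := by
    rw [𝒯.eq_path _ (hpp.dropUntil hv)]
    exact (𝒯.eq_path _ (by simp [h.symm.ne])).symm
  have h3 : p.edges = (𝒯.path 𝒯.root v).edges ++ [s(v, u)] := by
    conv_lhs => rw [← p.take_spec hv, SimpleGraph.Walk.edges_append, h1, h2]
    simp
  have hnd := hpp.isTrail.edges_nodup
  rw [h3, List.nodup_append] at hnd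
  simp only [node, ← hp, h3, List.mem_append, List.mem_singleton, Sym2.eq_swap (a := v)]
  by_cases he : e = s(u, v)
  · have : e ∉ (𝒯.path 𝒯.root v).edges := fun hm =>
      hnd.2.2 e hm s(v, u) (by simp) (by rw [he, Sym2.eq_swap])
    simp [he] at this ⊢
    simp [this]
  · simp [he]

theorem node_adj (𝒯 : WeightedTree V) {u v : V} (h : 𝒯.graph.Adj u v) (e : Sym2 V) :
    |𝒯.node u e - 𝒯.node v e| = if e = s(u, v) then (𝒯.length e : ℝ) else 0 := by
  by_cases hv : v ∈ (𝒯.path 𝒯.root u).support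
  · exact 𝒯.node_of_mem h hv e
  · have hc : ((𝒯.path 𝒯.root u).concat h).IsPath :=
      (SimpleGraph.Walk.concat_isPath_iff h).2 ⟨𝒯.path_isPath _ _, hv⟩
    have hu : u ∈ (𝒯.path 𝒯.root v).support := by
      rw [← 𝒯.eq_path _ hc]
      simp [SimpleGraph.Walk.support_concat]
    rw [abs_sub_comm, Sym2.eq_swap]
    exact 𝒯.node_of_mem h.symm hu e

theorem node_path (𝒯 : WeightedTree V) {u v : V} (p : 𝒯.graph.Walk u v) (hp : p.IsPath)
    (e : Sym2 V) : |𝒯.node u e - 𝒯.node v e| = if e ∈ p.edges then (𝒯.length e : ℝ) else 0 := by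
  induction p with
  | nil => simp
  | @cons u w v h p ih =>
    have ih := ih hp.of_cons
    have ha := 𝒯.node_adj h e
    have hnd := hp.isTrail.edges_nodup
    rw [SimpleGraph.Walk.edges_cons, List.nodup_cons] at hnd
    rw [SimpleGraph.Walk.edges_cons]
    by_cases he : e = s(u, w)
    · rw [← he] at hnd
      rw [if_neg hnd.1, abs_eq_zero, sub_eq_zero] at ih
      rw [← ih, ha, if_pos he, if_pos (by simp [he])]
    · rw [if_neg he, abs_eq_zero, sub_eq_zero] at ha
      rw [ha, ih]
      simp [he]

/-- The distance between two nodes is the sum of the lengths of the edges of the path. -/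
theorem dist_node (𝒯 : WeightedTree V) (u v : V) :
    dist (𝒯.node u) (𝒯.node v) = ((𝒯.path u v).edges.map fun e => (𝒯.length e : ℝ)).sum := by
  have hp := 𝒯.path_isPath u v
  rw [dist_eq_sum, ← List.sum_toFinset _ hp.isTrail.edges_nodup,
    Finset.sum_congr rfl fun e _ => 𝒯.node_path _ hp e, ← Finset.sum_filter]
  refine Finset.sum_congr ?_ fun _ _ => rfl
  ext e
  simp

/-- Every edge is an isometric copy of an interval of the prescribed length. -/
theorem dist_edge (𝒯 : WeightedTree V) {u v : V} (h : 𝒯.graph.Adj u v) (s t : ℝ) :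
    dist (AffineMap.lineMap (𝒯.node u) (𝒯.node v) s) (AffineMap.lineMap (𝒯.node u) (𝒯.node v) t)
      = |s - t| * 𝒯.length s(u, v) := by
  rw [dist_lineMap_lineMap, Real.dist_eq, dist_eq_sum,
    Finset.sum_congr rfl fun e _ => 𝒯.node_adj h e]
  simp

theorem node_eq_off (𝒯 : WeightedTree V) {u v : V} (h : 𝒯.graph.Adj u v) {f : Sym2 V}
    (hf : f ≠ s(u, v)) {x : PiLp 1 (fun _ : Sym2 V => ℝ)}
    (hx : x ∈ segment ℝ (𝒯.node u) (𝒯.node v)) {a : V} (ha : a ∈ s(u, v)) :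
    x f = 𝒯.node a f := by
  have h1 := 𝒯.node_adj h f
  rw [if_neg hf, abs_eq_zero, sub_eq_zero] at h1
  obtain ⟨p, q, -, -, hpq, rfl⟩ := hx
  have h2 : 𝒯.node a f = 𝒯.node v f := by
    rcases Sym2.mem_iff.1 ha with rfl | rfl
    · exact h1
    · rfl
  simp only [PiLp.add_apply, PiLp.smul_apply, smul_eq_mul]
  rw [h1, h2, ← add_mul, hpq, one_mul]

theorem exists_node_eq (𝒯 : WeightedTree V) {u v : V} (h : 𝒯.graph.Adj u v) (z : V) :
    ∃ a ∈ s(u, v), 𝒯.node a s(u, v) = 𝒯.node z s(u, v) := by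
  have h1 := 𝒯.node_adj h s(u, v)
  rw [if_pos rfl] at h1
  have h0 : ∀ w, 𝒯.node w s(u, v) = 𝒯.length s(u, v) ∨ 𝒯.node w s(u, v) = 0 := fun w => by
    simp only [node]
    split_ifs <;> simp
  rcases h0 u with hu | hu <;> rcases h0 v with hv | hv <;> rcases h0 z with hz | hz <;>
    rw [hu, hv] at h1 <;> simp at h1 <;>
    first
      | (refine ⟨u, by simp, ?_⟩; rw [hu, hz]; done)
      | (refine ⟨v, by simp, ?_⟩; rw [hv, hz]; done)
      | (refine ⟨u, by simp, ?_⟩; simp [hu, hz, h1])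

/-- The path between points on different edges runs through end points of these edges. -/
theorem dist_gate (𝒯 : WeightedTree V) {u v u' v' : V} (h : 𝒯.graph.Adj u v)
    (h' : 𝒯.graph.Adj u' v') (hne : s(u, v) ≠ s(u', v')) {x y : PiLp 1 (fun _ : Sym2 V => ℝ)}
    (hx : x ∈ segment ℝ (𝒯.node u) (𝒯.node v)) (hy : y ∈ segment ℝ (𝒯.node u') (𝒯.node v')) :
    ∃ a ∈ s(u, v), ∃ b ∈ s(u', v'), dist x y =
      dist x (𝒯.node a) + dist (𝒯.node a) (𝒯.node b) + dist (𝒯.node b) y := by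
  obtain ⟨a, ha, ha'⟩ := 𝒯.exists_node_eq h u'
  obtain ⟨b, hb, hb'⟩ := 𝒯.exists_node_eq h' u
  refine ⟨a, ha, b, hb, ?_⟩
  simp only [dist_eq_sum, ← Finset.sum_add_distrib]
  refine Finset.sum_congr rfl fun f _ => ?_
  by_cases hf : f = s(u, v)
  · subst hf
    have h1 := 𝒯.node_eq_off h' hne hy hb
    have h2 := 𝒯.node_eq_off h' hne hy (Sym2.mem_mk_left u' v')
    rw [ha', ← h1, ← h2]
    simp
  · have h1 := 𝒯.node_eq_off h hf hx ha
    rw [h1]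
    by_cases hf' : f = s(u', v')
    · subst hf'
      have h2 := 𝒯.node_eq_off h hf hx (Sym2.mem_mk_left u v)
      rw [← h1, h2, hb']
      simp
    · have h3 := 𝒯.node_eq_off h' hf' hy hb
      rw [h3]
      simp

end WeightedTree

section EntropyPartialTransport

variable {X : Type*} [MeasurableSpace X]

/-- The finite measures `γ` on the product whose marginals satisfy `γ₁ ≤ μ` and `γ₂ ≤ ν`. -/
def subPlans (μ ν : FiniteMeasure X) : Set (FiniteMeasure (X × X)) :=
  {γ | (γ : Measure (X × X)).map Prod.fst ≤ (μ : Measure X) ∧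
    (γ : Measure (X × X)).map Prod.snd ≤ (ν : Measure X)}

/-- The weighted relative entropy `∫ w F(f) dμ` of the measure `σ = f μ`,
for the entropy function `F(s) = |s - 1|`. -/
def relEntropy (w : X → ℝ) (σ μ : Measure X) : ℝ :=
  ∫ x, w x * |(σ.rnDeriv μ x).toReal - 1| ∂μ

/-- The objective of the entropy partial transport problem, with the distance as cost. -/
def entropyCost [Dist X] (b lam : ℝ) (w₁ w₂ : X → ℝ) (μ ν : FiniteMeasure X)
    (γ : FiniteMeasure (X × X)) : ℝ :=
  relEntropy w₁ ((γ : Measure (X × X)).map Prod.fst) μ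
    + relEntropy w₂ ((γ : Measure (X × X)).map Prod.snd) ν
    + b * ∫ z, (dist z.1 z.2 - lam) ∂(γ : Measure (X × X))

/-- The entropy partial transport problem `ET_λ(μ, ν)`. The infimum is over a set that contains
`γ = 0`, of values at least `-bλ μ(X)` when `b, λ, w₁, w₂` are nonnegative and `X` is bounded. -/
def entropyTransport [Dist X] (b lam : ℝ) (w₁ w₂ : X → ℝ) (μ ν : FiniteMeasure X) : ℝ :=
  sInf (entropyCost b lam w₁ w₂ μ ν '' subPlans μ ν)

/-- `d(μ, ν) = ET_λ(μ, ν) + (bλ/2) [μ(X) + ν(X)]`. -/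
def entropyDist [Dist X] (b lam : ℝ) (w₁ w₂ : X → ℝ) (μ ν : FiniteMeasure X) : ℝ :=
  entropyTransport b lam w₁ w₂ μ ν + b * lam / 2 * ((μ.mass : ℝ) + (ν.mass : ℝ))

end EntropyPartialTransport

/-- A divergence: nonnegative, and zero exactly on the diagonal. -/
def IsDivergence {M : Type*} (d : M → M → ℝ) : Prop :=
  (∀ x y, 0 ≤ d x y) ∧ ∀ x y, d x y = 0 ↔ x = y

/-- `d` is the distance of a metric space structure on `M` that is complete. -/
def IsCompleteMetric {M : Type*} (d : M → M → ℝ) : Prop :=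
  ∃ m : MetricSpace M, (∀ x y, m.dist x y = d x y) ∧
    @CompleteSpace M m.toPseudoMetricSpace.toUniformSpace

/-- Any two points `x, y` are joined by a path `φ : [0, a] → M`, `a = d x y`, which is an
isometric embedding (the values of `φ` outside `[0, a]` play no role). -/
def IsGeodesic {M : Type*} (d : M → M → ℝ) : Prop :=
  ∀ x y, ∃ φ : ℝ → M, φ 0 = x ∧ φ (d x y) = y ∧
    ∀ t ∈ Set.Icc 0 (d x y), ∀ s ∈ Set.Icc 0 (d x y), d (φ t) (φ s) = |t - s|

end

/-! Write W_i = w_i + bλ/2. Everything rests on a dual formula: d(μ,ν) is the supremum of ∫f dμ − ∫f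
dν over the b-Lipschitz f with −W₂ ≤ f ≤ W₁, and the primal infimum is attained
(`exists_entropyDist_eq`). Weak duality is direct. The converse combines Hahn–Banach and Riesz
(`exists_plan`) with a c-transform that merges two potentials into one (`exists_potential`).

The formula sees only μ − ν, which gives (i); splitting μ − ν at σ under the supremum gives (ii). If
b > 0, a small multiple of any Lipschitz function is admissible. Lipschitz functions are dense in
C(X), so d separates measures, and along a d-Cauchy sequence the integrals of all continuous
functions converge; Riesz turns the limit functional into a measure. If w₁ = w₂, the substitution f
↦ −f gives symmetry.

For geodesics, take an optimal γ, put α = μ − γ₁, β = ν − γ₂, and let ψ(t) = (1−t)α + tβ + (e_t)_#γ,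
where e_t(x,y) is the point at fraction t of the path from x to y. The dual formula bounds
d(ψ(s),ψ(t)) by |s−t| d(μ,ν), and the triangle inequality forces equality. Apart from compactness,
the tree matters only for e_t: paths exist by `joinedBy_dist`, and e_t is continuous because a point
of a path is determined by its distances to the ends (`eq_of_dist_eq`). -/

noncomputable section

set_option linter.unusedSectionVars false

/-! ### Finite measures as positive functionals on C(X) -/

section Riesz

variable {X : Type*} [MetricSpace X] [CompactSpace X] [MeasurableSpace X] [BorelSpace X]

theorem ContinuousMap.integrable_of_compactSpace (f : C(X, ℝ)) (μ : Measure X)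
    [IsFiniteMeasure μ] : Integrable f μ :=
  f.continuous.integrable_of_hasCompactSupport (HasCompactSupport.of_compactSpace _)

theorem Continuous.integrable_of_compactSpace {f : X → ℝ} (hf : Continuous f) (μ : Measure X)
    [IsFiniteMeasure μ] : Integrable f μ :=
  hf.integrable_of_hasCompactSupport (HasCompactSupport.of_compactSpace _)

/-- A positive linear functional on the continuous functions of a compact space is the integral
with respect to a finite measure. -/
theorem exists_finiteMeasure_integral_eq (ℓ : C(X, ℝ) →ₗ[ℝ] ℝ) (hℓ : ∀ f, 0 ≤ f → 0 ≤ ℓ f) :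
    ∃ μ : FiniteMeasure X, ∀ f : C(X, ℝ), ∫ x, f x ∂(μ : Measure X) = ℓ f := by
  let toC : CompactlySupportedContinuousMap X ℝ →ₗ[ℝ] C(X, ℝ) :=
    { toFun := fun f => f.toContinuousMap
      map_add' := fun _ _ => rfl
      map_smul' := fun _ _ => rfl }
  let Λ : CompactlySupportedContinuousMap X ℝ →ₚ[ℝ] ℝ :=
    PositiveLinearMap.mk₀ (ℓ ∘ₗ toC) fun f hf => hℓ _ fun x => hf x
  have : IsFiniteMeasure (RealRMK.rieszMeasure Λ) :=
    ⟨isCompact_univ.measure_lt_top⟩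
  refine ⟨⟨RealRMK.rieszMeasure Λ, this⟩, fun f => ?_⟩
  exact RealRMK.integral_rieszMeasure Λ (CompactlySupportedContinuousMap.continuousMapEquiv f)

theorem measure_ext_of_continuousMap {μ ν : Measure X} [IsFiniteMeasure μ] [IsFiniteMeasure ν]
    (h : ∀ f : C(X, ℝ), ∫ x, f x ∂μ = ∫ x, f x ∂ν) : μ = ν :=
  ext_of_forall_integral_eq_of_IsFiniteMeasure fun f => h f.toContinuousMap

/-- Domination of finite measures can be tested on nonnegative continuous functions. -/
theorem measure_le_of_integral_le {σ μ : Measure X} [IsFiniteMeasure σ] [IsFiniteMeasure μ]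
    (h : ∀ f : C(X, ℝ), 0 ≤ f → ∫ x, f x ∂σ ≤ ∫ x, f x ∂μ) : σ ≤ μ := by
  let ℓ : C(X, ℝ) →ₗ[ℝ] ℝ :=
    { toFun := fun f => ∫ x, f x ∂μ - ∫ x, f x ∂σ
      map_add' := fun f g => by
        simp only [ContinuousMap.add_apply]
        rw [integral_add (f.integrable_of_compactSpace _) (g.integrable_of_compactSpace _),
          integral_add (f.integrable_of_compactSpace _) (g.integrable_of_compactSpace _)]
        ring
      map_smul' := fun c f => by
        simp only [ContinuousMap.smul_apply, smul_eq_mul, integral_const_mul, RingHom.id_apply]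
        ring }
  obtain ⟨ρ, hρ⟩ := exists_finiteMeasure_integral_eq ℓ fun f hf => sub_nonneg.2 (h f hf)
  have : μ = σ + ρ := by
    refine measure_ext_of_continuousMap fun f => ?_
    rw [integral_add_measure (f.integrable_of_compactSpace _) (f.integrable_of_compactSpace _), hρ]
    simp [ℓ]
  rw [this]
  exact Measure.le_add_right le_rfl

end Riesz

/-! ### Rewriting the cost of a plan -/

section Cost

variable {X : Type*} [MetricSpace X] [CompactSpace X] [MeasurableSpace X] [BorelSpace X]

/-- Domination σ ≤ μ makes the density at most 1, so |f − 1| = 1 − f and the entropy becomes linear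
in σ. -/
theorem relEntropy_eq {w : X → ℝ} (hw : Continuous w) {σ μ : Measure X} [IsFiniteMeasure μ]
    (h : σ ≤ μ) : relEntropy w σ μ = ∫ x, w x ∂μ - ∫ x, w x ∂σ := by
  have : IsFiniteMeasure σ := isFiniteMeasure_of_le μ h
  have hac : σ ≪ μ := Measure.absolutelyContinuous_of_le h
  have hi : Integrable (fun x => (σ.rnDeriv μ x).toReal * w x) μ :=
    (integrable_rnDeriv_smul_iff hac).2 (hw.integrable_of_compactSpace σ)
  rw [← integral_toReal_rnDeriv_mul hac, ← integral_sub (hw.integrable_of_compactSpace μ) hi]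
  refine integral_congr_ae ?_
  filter_upwards [Measure.rnDeriv_le_one_of_le h] with x hx
  have hx1 : (σ.rnDeriv μ x).toReal ≤ 1 :=
    ENNReal.toReal_le_of_le_ofReal zero_le_one (by simpa using hx)
  rw [abs_of_nonpos (by linarith)]
  ring

/-- The cost of a plan, with the marginals eliminated. -/
theorem entropyCost_add {b lam : ℝ} {w₁ w₂ : X → ℝ} (hw₁ : Continuous w₁) (hw₂ : Continuous w₂)
    {μ ν : FiniteMeasure X} {γ : FiniteMeasure (X × X)} (hγ : γ ∈ subPlans μ ν) :
    entropyCost b lam w₁ w₂ μ ν γ + b * lam / 2 * ((μ.mass : ℝ) + (ν.mass : ℝ)) =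
      ∫ x, (w₁ x + b * lam / 2) ∂(μ : Measure X) + ∫ x, (w₂ x + b * lam / 2) ∂(ν : Measure X)
        + ∫ z, (b * dist z.1 z.2 - (w₁ z.1 + b * lam / 2) - (w₂ z.2 + b * lam / 2))
            ∂(γ : Measure (X × X)) := by
  have h1 : ∫ x, w₁ x ∂(γ : Measure (X × X)).map Prod.fst = ∫ z, w₁ z.1 ∂(γ : Measure (X × X)) :=
    integral_map measurable_fst.aemeasurable hw₁.aestronglyMeasurable
  have h2 : ∫ x, w₂ x ∂(γ : Measure (X × X)).map Prod.snd = ∫ z, w₂ z.2 ∂(γ : Measure (X × X)) :=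
    integral_map measurable_snd.aemeasurable hw₂.aestronglyMeasurable
  have i1 : Integrable (fun z : X × X => w₁ z.1) (γ : Measure (X × X)) :=
    (hw₁.comp continuous_fst).integrable_of_compactSpace _
  have i2 : Integrable (fun z : X × X => w₂ z.2) (γ : Measure (X × X)) :=
    (hw₂.comp continuous_snd).integrable_of_compactSpace _
  have i3 : Integrable (fun z : X × X => b * (dist z.1 z.2 - lam)) (γ : Measure (X × X)) :=
    Continuous.integrable_of_compactSpace (by fun_prop) _
  have h3 : ∫ z, (b * dist z.1 z.2 - (w₁ z.1 + b * lam / 2) - (w₂ z.2 + b * lam / 2))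
      ∂(γ : Measure (X × X)) = b * ∫ z, (dist z.1 z.2 - lam) ∂(γ : Measure (X × X))
        - ∫ z, w₁ z.1 ∂(γ : Measure (X × X)) - ∫ z, w₂ z.2 ∂(γ : Measure (X × X)) := by
    rw [← integral_const_mul, ← integral_sub i3 i1, ← integral_sub (i3.sub' i1) i2]
    exact integral_congr_ae (Filter.Eventually.of_forall fun z => by ring)
  rw [h3, entropyCost, relEntropy_eq hw₁ hγ.1, relEntropy_eq hw₂ hγ.2, h1, h2,
    integral_add (hw₁.integrable_of_compactSpace _) (integrable_const _),
    integral_add (hw₂.integrable_of_compactSpace _) (integrable_const _)]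
  simp only [integral_const, smul_eq_mul]
  have hm (m : FiniteMeasure X) : (m : Measure X).real Set.univ = m.mass := rfl
  rw [hm, hm]
  ring

end Cost

/-! ### Kantorovich-type duality for partial transport -/

section Duality

variable {X : Type*} [MetricSpace X] [MeasurableSpace X]

/-- The admissible potentials of the dual problem. -/
def potentials (b : ℝ≥0) (W₁ W₂ : X → ℝ) : Set (X → ℝ) :=
  {f | LipschitzWith b f ∧ ∀ x, f x ≤ W₁ x ∧ -W₂ x ≤ f x}

variable [CompactSpace X] [BorelSpace X] {b : ℝ≥0} {W₁ W₂ : X → ℝ}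

/-- Since W₁ − f and W₂ + f are nonnegative, their integrals grow when the marginals of γ are
replaced by μ and ν; the Lipschitz bound on f(x) − f(y) does the rest. -/
theorem weak_duality (hW₁ : Continuous W₁) (hW₂ : Continuous W₂) {μ ν : FiniteMeasure X}
    {γ : FiniteMeasure (X × X)} (hγ : γ ∈ subPlans μ ν) {f : X → ℝ} (hf : f ∈ potentials b W₁ W₂) :
    ∫ x, f x ∂(μ : Measure X) - ∫ x, f x ∂(ν : Measure X) ≤
      ∫ x, W₁ x ∂(μ : Measure X) + ∫ x, W₂ x ∂(ν : Measure X)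
        + ∫ z, (b * dist z.1 z.2 - W₁ z.1 - W₂ z.2) ∂(γ : Measure (X × X)) := by
  have hfc := hf.1.continuous
  have e1 : ∫ z : X × X, (W₁ z.1 - f z.1) ∂(γ : Measure (X × X)) ≤
      ∫ x, (W₁ x - f x) ∂(μ : Measure X) := by
    rw [← integral_map (f := fun x => W₁ x - f x) measurable_fst.aemeasurable
      (hW₁.sub hfc).aestronglyMeasurable]
    exact integral_mono_measure hγ.1 (Filter.Eventually.of_forall fun x => sub_nonneg.2 (hf.2 x).1)
      ((hW₁.sub hfc).integrable_of_compactSpace _)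
  have e2 : ∫ z : X × X, (W₂ z.2 + f z.2) ∂(γ : Measure (X × X)) ≤
      ∫ x, (W₂ x + f x) ∂(ν : Measure X) := by
    rw [← integral_map (f := fun x => W₂ x + f x) measurable_snd.aemeasurable
      (hW₂.add hfc).aestronglyMeasurable]
    exact integral_mono_measure hγ.2 (Filter.Eventually.of_forall fun x => by
      have := (hf.2 x).2
      simp only [Pi.zero_apply]
      linarith) ((hW₂.add hfc).integrable_of_compactSpace _)
  have i1 : Integrable (fun z : X × X => W₁ z.1 - f z.1) (γ : Measure (X × X)) :=
    ((hW₁.sub hfc).comp continuous_fst).integrable_of_compactSpace _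
  have i2 : Integrable (fun z : X × X => W₂ z.2 + f z.2) (γ : Measure (X × X)) :=
    ((hW₂.add hfc).comp continuous_snd).integrable_of_compactSpace _
  have e3 : - ∫ z : X × X, (W₁ z.1 - f z.1) ∂(γ : Measure (X × X))
      - ∫ z : X × X, (W₂ z.2 + f z.2) ∂(γ : Measure (X × X)) ≤
      ∫ z, (b * dist z.1 z.2 - W₁ z.1 - W₂ z.2) ∂(γ : Measure (X × X)) := by
    rw [← integral_neg, ← integral_sub i1.fun_neg i2]
    refine integral_mono (i1.neg.sub i2) (Continuous.integrable_of_compactSpace (by fun_prop) _)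
      fun z => ?_
    have := hf.1.dist_le_mul z.1 z.2
    rw [Real.dist_eq] at this
    have := le_of_abs_le this
    linarith
  rw [integral_sub (hW₁.integrable_of_compactSpace _) (hfc.integrable_of_compactSpace _)] at e1
  rw [integral_add (hW₂.integrable_of_compactSpace _) (hfc.integrable_of_compactSpace _)] at e2
  linarith

/-- The `c`-transform turns a pair of potentials into a single one. -/
theorem exists_potential (hL₁ : LipschitzWith b W₁) (hL₂ : LipschitzWith b W₂)
    (h0₁ : ∀ x, 0 ≤ W₁ x) (h0₂ : ∀ x, 0 ≤ W₂ x) {φ ψ : X → ℝ}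
    (hφ : ∀ x, φ x ≤ W₁ x) (hψ : ∀ x, ψ x ≤ W₂ x) (h : ∀ x y, φ x + ψ y ≤ b * dist x y) :
    ∃ f ∈ potentials b W₁ W₂, ∀ x, φ x ≤ f x ∧ f x ≤ -ψ x := by
  have hlow : ∀ x y, -W₂ x ≤ b * dist x y - ψ y := fun x y => by
    have := hL₂.dist_le_mul x y
    rw [Real.dist_eq] at this
    have := neg_le_of_abs_le this
    have := hψ y
    linarith
  have hbdd : ∀ x, BddBelow (Set.range fun y => b * dist x y - ψ y) := fun x =>
    ⟨-W₂ x, by rintro _ ⟨y, rfl⟩; exact hlow x y⟩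
  have hg : LipschitzWith b fun x => ⨅ y, (b * dist x y - ψ y) := by
    refine LipschitzWith.of_le_add_mul b fun x x' => ?_
    have : Nonempty X := ⟨x⟩
    rw [← sub_le_iff_le_add]
    refine le_ciInf fun y => ?_
    have h1 := ciInf_le (hbdd x) y
    have h2 := mul_le_mul_of_nonneg_left (dist_triangle x x' y) b.coe_nonneg
    linarith
  -- The infimum is the c-transform of ψ; it stays above −W₂ because ψ ≤ W₂ and W₂ is b-Lipschitz.
  -- Truncating at W₁ keeps this bound because W₁ ≥ 0 ≥ −W₂.
  refine ⟨fun x => min (W₁ x) (⨅ y, (b * dist x y - ψ y)), ⟨?_, fun x => ⟨min_le_left _ _, ?_⟩⟩,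
    fun x => ⟨?_, ?_⟩⟩
  · simpa using hL₁.min hg
  · have : Nonempty X := ⟨x⟩
    exact le_min (by linarith [h0₁ x, h0₂ x]) (le_ciInf (hlow x))
  · have : Nonempty X := ⟨x⟩
    exact le_min (hφ x) (le_ciInf fun y => by linarith [h x y])
  · exact (min_le_right _ _).trans ((ciInf_le (hbdd x) x).trans (by simp))

/-- The values of the problem dual to maximizing `∫ h dγ` over the plans `γ ∈ subPlans μ ν`. -/
def coverValues (μ ν : FiniteMeasure X) (h : C(X × X, ℝ)) : Set ℝ :=
  {r | ∃ φ ψ : C(X, ℝ), 0 ≤ φ ∧ 0 ≤ ψ ∧ (∀ x y, h (x, y) ≤ φ x + ψ y) ∧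
    r = ∫ x, φ x ∂(μ : Measure X) + ∫ x, ψ x ∂(ν : Measure X)}

theorem coverValues_nonneg {μ ν : FiniteMeasure X} {h : C(X × X, ℝ)} {r : ℝ}
    (hr : r ∈ coverValues μ ν h) : 0 ≤ r := by
  obtain ⟨φ, ψ, hφ, hψ, -, rfl⟩ := hr
  exact add_nonneg (integral_nonneg hφ) (integral_nonneg hψ)

theorem coverValues_bddBelow (μ ν : FiniteMeasure X) (h : C(X × X, ℝ)) :
    BddBelow (coverValues μ ν h) := ⟨0, fun _ => coverValues_nonneg⟩

theorem coverValues_nonempty (μ ν : FiniteMeasure X) (h : C(X × X, ℝ)) :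
    (coverValues μ ν h).Nonempty :=
  ⟨_, ContinuousMap.const X ‖h‖, 0, fun _ => norm_nonneg h, le_rfl, fun x y => by
    simpa using (le_abs_self _).trans (h.norm_coe_le_norm (x, y)), rfl⟩

theorem sInf_coverValues_nonneg (μ ν : FiniteMeasure X) (h : C(X × X, ℝ)) :
    0 ≤ sInf (coverValues μ ν h) := Real.sInf_nonneg fun _ => coverValues_nonneg

/-- Covers add up. Together with positive homogeneity this is the sublinearity that Hahn–Banach
requires. -/
theorem sInf_coverValues_add_le (μ ν : FiniteMeasure X) (g h : C(X × X, ℝ)) :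
    sInf (coverValues μ ν (g + h)) ≤ sInf (coverValues μ ν g) + sInf (coverValues μ ν h) := by
  rw [← csInf_add (coverValues_nonempty _ _ _) (coverValues_bddBelow _ _ _)
    (coverValues_nonempty _ _ _) (coverValues_bddBelow _ _ _)]
  refine csInf_le_csInf (coverValues_bddBelow _ _ _)
    ((coverValues_nonempty _ _ _).add (coverValues_nonempty _ _ _)) ?_
  rintro _ ⟨_, ⟨φ, ψ, hφ, hψ, hg, rfl⟩, _, ⟨φ', ψ', hφ', hψ', hh, rfl⟩, rfl⟩
  refine ⟨φ + φ', ψ + ψ', add_nonneg hφ hφ', add_nonneg hψ hψ', fun x y => ?_, ?_⟩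
  · simpa using (add_le_add (hg x y) (hh x y)).trans_eq (by ring)
  · simp only [ContinuousMap.add_apply]
    rw [integral_add (φ.integrable_of_compactSpace _) (φ'.integrable_of_compactSpace _),
      integral_add (ψ.integrable_of_compactSpace _) (ψ'.integrable_of_compactSpace _)]
    ring

theorem sInf_coverValues_smul_le (μ ν : FiniteMeasure X) (h : C(X × X, ℝ)) {c : ℝ} (hc : 0 < c) :
    sInf (coverValues μ ν (c • h)) ≤ c * sInf (coverValues μ ν h) := by
  rw [← smul_eq_mul, ← Real.sInf_smul_of_nonneg hc.le]
  refine csInf_le_csInf (coverValues_bddBelow _ _ _) (coverValues_nonempty _ _ _).smul_set ?_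
  rintro _ ⟨_, ⟨φ, ψ, hφ, hψ, hg, rfl⟩, rfl⟩
  refine ⟨c • φ, c • ψ, smul_nonneg hc.le hφ, smul_nonneg hc.le hψ, fun x y => ?_, ?_⟩
  · simpa [← mul_add] using mul_le_mul_of_nonneg_left (hg x y) hc.le
  · simp only [ContinuousMap.smul_apply, smul_eq_mul, integral_const_mul]
    ring

theorem sInf_coverValues_smul (μ ν : FiniteMeasure X) (h : C(X × X, ℝ)) {c : ℝ} (hc : 0 < c) :
    sInf (coverValues μ ν (c • h)) = c * sInf (coverValues μ ν h) := by
  refine (sInf_coverValues_smul_le μ ν h hc).antisymm ?_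
  have := sInf_coverValues_smul_le μ ν (c • h) (inv_pos.2 hc)
  rwa [inv_smul_smul₀ hc.ne', le_inv_mul_iff₀ hc] at this

/-- Strong duality: some plan attains the dual value. -/
theorem exists_plan (μ ν : FiniteMeasure X) (h : C(X × X, ℝ)) :
    ∃ γ ∈ subPlans μ ν, ∫ z, h z ∂(γ : Measure (X × X)) = sInf (coverValues μ ν h) := by
  obtain ⟨ℓ, hℓh, hℓ⟩ : ∃ ℓ : C(X × X, ℝ) →ₗ[ℝ] ℝ, ℓ h = sInf (coverValues μ ν h) ∧
      ∀ g, ℓ g ≤ sInf (coverValues μ ν g) := by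
    by_cases h0 : h = 0
    · refine ⟨0, ?_, fun g => sInf_coverValues_nonneg μ ν g⟩
      refine (sInf_coverValues_nonneg μ ν h).antisymm ?_
      exact csInf_le (coverValues_bddBelow _ _ _)
        ⟨0, 0, le_rfl, le_rfl, fun x y => by simp [h0], by simp⟩
    -- With p the dual value, extend c • h ↦ c p(h) from the line through h. For c ≤ 0 the
    -- domination is c p(h) ≤ 0 ≤ p(c • h).
    · obtain ⟨ℓ, h1, h2⟩ := exists_extension_of_le_sublinear
        (LinearPMap.mkSpanSingleton h (sInf (coverValues μ ν h)) h0)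
        (fun g => sInf (coverValues μ ν g)) (fun c hc g => sInf_coverValues_smul μ ν g hc)
        (sInf_coverValues_add_le μ ν) (by
          rintro ⟨g, hg⟩
          obtain ⟨c, rfl⟩ := Submodule.mem_span_singleton.1 hg
          rw [LinearPMap.mkSpanSingleton'_apply, smul_eq_mul]
          rcases lt_or_ge 0 c with hc | hc
          · exact (sInf_coverValues_smul μ ν h hc).ge
          · exact (mul_nonpos_of_nonpos_of_nonneg hc (sInf_coverValues_nonneg μ ν h)).trans
              (sInf_coverValues_nonneg μ ν _))
      refine ⟨ℓ, ?_, h2⟩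
      have := h1 ⟨h, Submodule.mem_span_singleton_self h⟩
      rw [this]
      exact LinearPMap.mkSpanSingleton'_apply_self _ _ _ _
  -- The pair (0, 0) covers −g, so ℓ(−g) ≤ 0. In the same way the covers (f, 0) and (0, f) give the
  -- two marginal bounds below.
  have hpos : ∀ g, 0 ≤ g → 0 ≤ ℓ g := fun g hg => by
    have h1 := (hℓ (-g)).trans (csInf_le (coverValues_bddBelow _ _ _)
      ⟨0, 0, le_rfl, le_rfl, fun x y => by simpa using hg (x, y), rfl⟩)
    simpa using h1
  obtain ⟨γ, hγ⟩ := exists_finiteMeasure_integral_eq ℓ hpos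
  refine ⟨γ, ⟨measure_le_of_integral_le fun f hf => ?_, measure_le_of_integral_le fun f hf => ?_⟩,
    (hγ h).trans hℓh⟩
  · rw [integral_map measurable_fst.aemeasurable f.continuous.aestronglyMeasurable]
    refine (hγ (f.comp ContinuousMap.fst)).trans_le ((hℓ _).trans ?_)
    exact csInf_le (coverValues_bddBelow _ _ _) ⟨f, 0, hf, le_rfl, fun x y => by simp, by simp⟩
  · rw [integral_map measurable_snd.aemeasurable f.continuous.aestronglyMeasurable]
    refine (hγ (f.comp ContinuousMap.snd)).trans_le ((hℓ _).trans ?_)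
    exact csInf_le (coverValues_bddBelow _ _ _) ⟨0, f, le_rfl, hf, fun x y => by simp, by simp⟩

/-- Duality for partial transport: there are no duality gap and an optimal plan. -/
theorem exists_plan_isLUB (hL₁ : LipschitzWith b W₁) (hL₂ : LipschitzWith b W₂)
    (h0₁ : ∀ x, 0 ≤ W₁ x) (h0₂ : ∀ x, 0 ≤ W₂ x) (μ ν : FiniteMeasure X) :
    ∃ γ ∈ subPlans μ ν,
      IsLUB ((fun f => ∫ x, f x ∂(μ : Measure X) - ∫ x, f x ∂(ν : Measure X)) ''
          potentials b W₁ W₂)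
        (∫ x, W₁ x ∂(μ : Measure X) + ∫ x, W₂ x ∂(ν : Measure X)
          + ∫ z, (b * dist z.1 z.2 - W₁ z.1 - W₂ z.2) ∂(γ : Measure (X × X))) := by
  have hW₁ := hL₁.continuous
  have hW₂ := hL₂.continuous
  let h : C(X × X, ℝ) := ⟨fun z => W₁ z.1 + W₂ z.2 - b * dist z.1 z.2, by fun_prop⟩
  obtain ⟨γ, hγ, hγh⟩ := exists_plan μ ν h
  refine ⟨γ, hγ, ?_, fun r hr => ?_⟩
  · rintro _ ⟨f, hf, rfl⟩
    exact weak_duality hW₁ hW₂ hγ hf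
  · have e : ∫ z, (b * dist z.1 z.2 - W₁ z.1 - W₂ z.2) ∂(γ : Measure (X × X)) =
        - sInf (coverValues μ ν h) := by
      rw [← hγh, ← integral_neg]
      exact integral_congr_ae (Filter.Eventually.of_forall fun z => by simp [h]; ring)
    rw [e, ← sub_eq_add_neg, sub_le_comm]
    refine le_csInf (coverValues_nonempty _ _ _) ?_
    rintro _ ⟨φ, ψ, hφ, hψ, hle, rfl⟩
    -- The cover satisfies φ(x) + ψ(y) ≥ W₁(x) + W₂(y) − b dist x y, so W₁ − φ and W₂ − ψ form a
    -- pair to which the c-transform applies.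
    obtain ⟨f, hf, hf'⟩ := exists_potential hL₁ hL₂ h0₁ h0₂ (φ := fun x => W₁ x - φ x)
      (ψ := fun x => W₂ x - ψ x) (fun x => sub_le_self _ (hφ x)) (fun x => sub_le_self _ (hψ x))
      (fun x y => by
        have := hle x y
        simp only [h, ContinuousMap.coe_mk] at this
        linarith)
    have hfr := hr ⟨f, hf, rfl⟩
    have hfc := hf.1.continuous
    have e1 := integral_mono (μ := (μ : Measure X))
      (f := fun x => W₁ x - φ x)
      ((hW₁.sub φ.continuous).integrable_of_compactSpace _) (hfc.integrable_of_compactSpace _)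
      fun x => (hf' x).1
    have e2 := integral_mono (μ := (ν : Measure X)) (g := fun x => -(W₂ x - ψ x))
      (hfc.integrable_of_compactSpace _) ((hW₂.sub ψ.continuous).neg.integrable_of_compactSpace _)
      fun x => (hf' x).2
    rw [integral_sub (hW₁.integrable_of_compactSpace _) (φ.integrable_of_compactSpace _)] at e1
    rw [integral_neg, integral_sub (hW₂.integrable_of_compactSpace _)
      (ψ.integrable_of_compactSpace _)] at e2
    simp only at hfr
    linarith

/-- Duality for the entropy partial transport distance, and existence of an optimal plan. -/
theorem exists_entropyDist_eq {lam : ℝ} (hlam : 0 ≤ lam) {w₁ w₂ : X → ℝ}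
    (hw₁ : ∀ x, 0 < w₁ x) (hw₂ : ∀ x, 0 < w₂ x) (hL₁ : LipschitzWith b w₁)
    (hL₂ : LipschitzWith b w₂) (hW₁ : ∀ x, W₁ x = w₁ x + b * lam / 2)
    (hW₂ : ∀ x, W₂ x = w₂ x + b * lam / 2) (μ ν : FiniteMeasure X) :
    IsLUB ((fun f => ∫ x, f x ∂(μ : Measure X) - ∫ x, f x ∂(ν : Measure X)) ''
      potentials b W₁ W₂) (entropyDist (b : ℝ) lam w₁ w₂ μ ν) ∧
    ∃ γ ∈ subPlans μ ν, entropyDist (b : ℝ) lam w₁ w₂ μ ν =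
      ∫ x, W₁ x ∂(μ : Measure X) + ∫ x, W₂ x ∂(ν : Measure X)
        + ∫ z, (b * dist z.1 z.2 - W₁ z.1 - W₂ z.2) ∂(γ : Measure (X × X)) := by
  obtain rfl : W₁ = fun x => w₁ x + b * lam / 2 := funext hW₁
  obtain rfl : W₂ = fun x => w₂ x + b * lam / 2 := funext hW₂
  have hbl : 0 ≤ b * lam / 2 := by positivity
  have hLW₁ : LipschitzWith b fun x => w₁ x + b * lam / 2 := by
    simpa using hL₁.add (LipschitzWith.const (b * lam / 2 : ℝ))
  have hLW₂ : LipschitzWith b fun x => w₂ x + b * lam / 2 := by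
    simpa using hL₂.add (LipschitzWith.const (b * lam / 2 : ℝ))
  obtain ⟨γ, hγ, hlub⟩ := exists_plan_isLUB hLW₁ hLW₂ (fun x => by linarith [hw₁ x])
    (fun x => by linarith [hw₂ x]) μ ν
  -- The cost of γ, up to the mass term, is the dual supremum, which weak duality places below the
  -- cost of every plan.
  have key : entropyTransport (b : ℝ) lam w₁ w₂ μ ν = entropyCost (b : ℝ) lam w₁ w₂ μ ν γ := by
    refine IsLeast.csInf_eq ⟨⟨γ, hγ, rfl⟩, ?_⟩
    rintro _ ⟨γ', hγ', rfl⟩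
    have : _ ≤ _ := hlub.2 (by
      rintro _ ⟨f, hf, rfl⟩
      exact weak_duality hLW₁.continuous hLW₂.continuous hγ' hf)
    rw [← entropyCost_add hL₁.continuous hL₂.continuous hγ,
      ← entropyCost_add hL₁.continuous hL₂.continuous hγ'] at this
    linarith
  have := entropyCost_add (b := b) (lam := lam) hL₁.continuous hL₂.continuous hγ
  rw [← key] at this
  rw [← this] at hlub
  exact ⟨hlub, γ, hγ, this⟩

end Duality

/-! ### Density of Lipschitz functions -/

section LipschitzApprox

variable {X : Type*} [MetricSpace X] [CompactSpace X]

/-- Lipschitz functions are dense among the continuous functions on a compact metric space. -/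
theorem ContinuousMap.exists_lipschitz_approx (f : C(X, ℝ)) {ε : ℝ} (hε : 0 < ε) :
    ∃ g : C(X, ℝ), (∃ K, LipschitzWith K g) ∧ ∀ x, |f x - g x| ≤ ε := by
  -- Stone–Weierstrass: boundedness makes products of Lipschitz functions Lipschitz, and the
  -- functions `dist x ·` separate points.
  let A : Subalgebra ℝ C(X, ℝ) :=
    { carrier := {g | ∃ K, LipschitzWith K g}
      mul_mem' := by
        rintro f g ⟨K, hf⟩ ⟨L, hg⟩
        refine ⟨‖f‖₊ * L + ‖g‖₊ * K, LipschitzWith.of_dist_le_mul fun x y => ?_⟩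
        have h1 := hf.dist_le_mul x y
        have h2 := hg.dist_le_mul x y
        have h3 := f.norm_coe_le_norm x
        have h4 := g.norm_coe_le_norm y
        rw [Real.dist_eq] at h1 h2 ⊢
        rw [Real.norm_eq_abs] at h3 h4
        push_cast
        calc |(f * g) x - (f * g) y| = |f x * (g x - g y) + g y * (f x - f y)| := by
              simp only [ContinuousMap.mul_apply]
              ring_nf
          _ ≤ |f x| * |g x - g y| + |g y| * |f x - f y| := by
              rw [← abs_mul, ← abs_mul]
              exact abs_add_le _ _
          _ ≤ ‖f‖ * (L * dist x y) + ‖g‖ * (K * dist x y) := by gcongr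
          _ = _ := by ring
      add_mem' := by
        rintro f g ⟨K, hf⟩ ⟨L, hg⟩
        exact ⟨K + L, hf.add hg⟩
      algebraMap_mem' := fun r => ⟨0, LipschitzWith.const r⟩ }
  have hA : A.SeparatesPoints := fun x y hxy =>
    ⟨fun z => dist x z, ⟨⟨fun z => dist x z, by fun_prop⟩, ⟨1, LipschitzWith.dist_right x⟩, rfl⟩, by
      simpa using hxy⟩
  obtain ⟨⟨g, hg⟩, h⟩ := ContinuousMap.exists_mem_subalgebra_near_continuousMap_of_separatesPoints
    A hA f ε hε
  refine ⟨g, hg, fun x => ?_⟩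
  rw [abs_sub_comm]
  exact ((g - f).norm_coe_le_norm x).trans h.le

end LipschitzApprox

/-! ### Consequences of the dual formula -/

section DualDistance

variable {X : Type*} [MetricSpace X] [CompactSpace X] [MeasurableSpace X] [BorelSpace X]
  {b : ℝ≥0} {W₁ W₂ : X → ℝ} {d : FiniteMeasure X → FiniteMeasure X → ℝ}

/-- `d` is the supremum over the potentials of the difference of the integrals. -/
def IsDualDistance (b : ℝ≥0) (W₁ W₂ : X → ℝ) (d : FiniteMeasure X → FiniteMeasure X → ℝ) : Prop :=
  ∀ μ ν : FiniteMeasure X, IsLUB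
    ((fun f => ∫ x, f x ∂(μ : Measure X) - ∫ x, f x ∂(ν : Measure X)) '' potentials b W₁ W₂)
    (d μ ν)

namespace IsDualDistance

theorem sub_le (hd : IsDualDistance b W₁ W₂ d) {f : X → ℝ} (hf : f ∈ potentials b W₁ W₂)
    (μ ν : FiniteMeasure X) :
    ∫ x, f x ∂(μ : Measure X) - ∫ x, f x ∂(ν : Measure X) ≤ d μ ν :=
  (hd μ ν).1 ⟨f, hf, rfl⟩

theorem le (hd : IsDualDistance b W₁ W₂ d) {μ ν : FiniteMeasure X} {r : ℝ}
    (h : ∀ f ∈ potentials b W₁ W₂,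
      ∫ x, f x ∂(μ : Measure X) - ∫ x, f x ∂(ν : Measure X) ≤ r) : d μ ν ≤ r :=
  (hd μ ν).2 (by rintro _ ⟨f, hf, rfl⟩; exact h f hf)

theorem add_right (hd : IsDualDistance b W₁ W₂ d) (μ ν σ : FiniteMeasure X) :
    d (μ + σ) (ν + σ) = d μ ν := by
  suffices h : (fun f : X → ℝ => ∫ x, f x ∂((μ + σ : FiniteMeasure X) : Measure X)
      - ∫ x, f x ∂((ν + σ : FiniteMeasure X) : Measure X)) '' potentials b W₁ W₂ =
      (fun f => ∫ x, f x ∂(μ : Measure X) - ∫ x, f x ∂(ν : Measure X)) '' potentials b W₁ W₂ from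
    (hd (μ + σ) (ν + σ)).unique (h ▸ hd μ ν)
  refine Set.image_congr fun f hf => ?_
  have hi (m : FiniteMeasure X) : Integrable f (m : Measure X) :=
    hf.1.continuous.integrable_of_compactSpace _
  rw [FiniteMeasure.toMeasure_add, FiniteMeasure.toMeasure_add, integral_add_measure (hi _) (hi _),
    integral_add_measure (hi _) (hi _)]
  ring

theorem triangle (hd : IsDualDistance b W₁ W₂ d) (μ ν σ : FiniteMeasure X) :
    d μ ν ≤ d μ σ + d σ ν :=
  hd.le fun f hf => by linarith [hd.sub_le hf μ σ, hd.sub_le hf σ ν]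

theorem self_eq_zero (hd : IsDualDistance b W₁ W₂ d) (h₁ : ∀ x, 0 < W₁ x) (h₂ : ∀ x, 0 < W₂ x)
    (μ : FiniteMeasure X) : d μ μ = 0 :=
  (hd.le fun f _ => by simp).antisymm (by
    simpa using hd.sub_le (f := 0)
      ⟨LipschitzWith.const' 0, fun x => ⟨(h₁ x).le, by simpa using (h₂ x).le⟩⟩ μ μ)

theorem nonneg (hd : IsDualDistance b W₁ W₂ d) (h₁ : ∀ x, 0 < W₁ x) (h₂ : ∀ x, 0 < W₂ x)
    (μ ν : FiniteMeasure X) : 0 ≤ d μ ν := by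
  simpa using hd.sub_le (f := 0)
    ⟨LipschitzWith.const' 0, fun x => ⟨(h₁ x).le, by simpa using (h₂ x).le⟩⟩ μ ν

theorem symm (hd : IsDualDistance b W₁ W₁ d) (μ ν : FiniteMeasure X) : d μ ν = d ν μ := by
  have h : ∀ μ ν : FiniteMeasure X, d μ ν ≤ d ν μ := fun μ ν => hd.le fun f hf => by
    have := hd.sub_le (f := fun x => -f x) ⟨hf.1.neg, fun x =>
      ⟨by linarith [(hf.2 x).2], neg_le_neg (hf.2 x).1⟩⟩ ν μ
    rw [integral_neg, integral_neg] at this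
    linarith
  exact (h μ ν).antisymm (h ν μ)

end IsDualDistance

theorem exists_pos_le_of_compactSpace {W : X → ℝ} (hW : Continuous W) (h : ∀ x, 0 < W x) :
    ∃ m > 0, ∀ x, m ≤ W x := by
  rcases isEmpty_or_nonempty X with hX | hX
  · exact ⟨1, one_pos, fun x => (hX.false x).elim⟩
  · obtain ⟨x, -, hx⟩ := isCompact_univ.exists_isMinOn Set.univ_nonempty hW.continuousOn
    exact ⟨W x, h x, fun y => hx (Set.mem_univ y)⟩

namespace IsDualDistance

/-- Integrals of Lipschitz functions are controlled by `d`. -/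
theorem exists_abs_sub_le (hd : IsDualDistance b W₁ W₂ d) (hb : 0 < b)
    (hc₁ : Continuous W₁) (hc₂ : Continuous W₂) (h₁ : ∀ x, 0 < W₁ x) (h₂ : ∀ x, 0 < W₂ x)
    (g : C(X, ℝ)) {K : ℝ≥0} (hg : LipschitzWith K g) :
    ∃ C > 0, ∀ μ ν : FiniteMeasure X,
      |∫ x, g x ∂(μ : Measure X) - ∫ x, g x ∂(ν : Measure X)| ≤ C * d μ ν := by
  obtain ⟨m₁, hm₁, hmW₁⟩ := exists_pos_le_of_compactSpace hc₁ h₁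
  obtain ⟨m₂, hm₂, hmW₂⟩ := exists_pos_le_of_compactSpace hc₂ h₂
  -- The first term makes c g b-Lipschitz, the second keeps |c g| below both weights, so that c g
  -- and −c g are both admissible.
  set c : ℝ := min (b / (K + 1)) (min m₁ m₂ / (‖g‖ + 1)) with hc
  have hb' : (0 : ℝ) < b := hb
  have hg0 := norm_nonneg g
  have hc0 : 0 < c := lt_min (by positivity) (div_pos (lt_min hm₁ hm₂) (by positivity))
  have hcK : c * K ≤ b := by
    have h1 : c * (K + 1) ≤ b := (le_div_iff₀ (by positivity)).1 (min_le_left _ _)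
    nlinarith
  have hcg : ∀ x, |c * g x| ≤ min m₁ m₂ := fun x => by
    have h1 : c * (‖g‖ + 1) ≤ min m₁ m₂ := (le_div_iff₀ (by positivity)).1 (min_le_right _ _)
    have h2 : |g x| ≤ ‖g‖ := g.norm_coe_le_norm x
    rw [abs_mul, abs_of_pos hc0]
    nlinarith
  have key : ∀ s : ℝ, |s| = 1 → (fun x => s * (c * g x)) ∈ potentials b W₁ W₂ := fun s hs => by
    refine ⟨LipschitzWith.of_dist_le_mul fun x y => ?_, fun x => ?_⟩
    · have h1 := hg.dist_le_mul x y
      rw [Real.dist_eq] at h1 ⊢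
      rw [← mul_sub, ← mul_sub, abs_mul, abs_mul, hs, one_mul, abs_of_pos hc0]
      calc c * |g x - g y| ≤ c * (K * dist x y) := by gcongr
        _ = c * K * dist x y := by ring
        _ ≤ b * dist x y := by gcongr
    · have h1 : |s * (c * g x)| ≤ min m₁ m₂ := by
        rw [abs_mul, hs, one_mul]
        exact hcg x
      have h2 := abs_le.1 h1
      have h3 := min_le_left m₁ m₂
      have h4 := min_le_right m₁ m₂
      exact ⟨by linarith [hmW₁ x], by linarith [hmW₂ x]⟩
  refine ⟨c⁻¹, inv_pos.2 hc0, fun μ ν => ?_⟩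
  have e1 := hd.sub_le (key 1 (by simp)) μ ν
  have e2 := hd.sub_le (key (-1) (by simp)) μ ν
  simp only [integral_const_mul] at e1 e2
  rw [le_inv_mul_iff₀ hc0]
  nth_rw 1 [← abs_of_pos hc0]
  rw [← abs_mul]
  exact abs_le.2 ⟨by linarith, by linarith⟩

end IsDualDistance

theorem abs_integral_sub_le (f g : C(X, ℝ)) {ε : ℝ} (h : ∀ x, |f x - g x| ≤ ε)
    (μ : FiniteMeasure X) :
    |∫ x, f x ∂(μ : Measure X) - ∫ x, g x ∂(μ : Measure X)| ≤ ε * μ.mass := by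
  rw [← integral_sub (f.integrable_of_compactSpace _) (g.integrable_of_compactSpace _)]
  exact norm_integral_le_of_norm_le_const (μ := (μ : Measure X))
    (f := fun x => f x - g x) (Filter.Eventually.of_forall h)

namespace IsDualDistance

/-- At distance zero all Lipschitz integrals agree; density extends this to continuous functions,
which determine the measure. -/
theorem eq_of_eq_zero (hd : IsDualDistance b W₁ W₂ d) (hb : 0 < b)
    (hc₁ : Continuous W₁) (hc₂ : Continuous W₂) (h₁ : ∀ x, 0 < W₁ x) (h₂ : ∀ x, 0 < W₂ x)
    {μ ν : FiniteMeasure X} (h : d μ ν = 0) : μ = ν := by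
  refine FiniteMeasure.toMeasure_injective (measure_ext_of_continuousMap fun f => ?_)
  rw [← sub_eq_zero, ← abs_nonpos_iff]
  refine le_of_forall_pos_le_add fun ε hε => ?_
  have hM : (0 : ℝ) < μ.mass + ν.mass + 1 := by positivity
  obtain ⟨g, ⟨K, hg⟩, hfg⟩ := f.exists_lipschitz_approx (div_pos hε hM)
  obtain ⟨C, -, hC⟩ := hd.exists_abs_sub_le hb hc₁ hc₂ h₁ h₂ g hg
  have e0 := hC μ ν
  rw [h, mul_zero] at e0
  have e1 := abs_le.1 (abs_integral_sub_le f g hfg μ)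
  have e2 := abs_le.1 (abs_integral_sub_le f g hfg ν)
  have e3 := abs_le.1 e0
  have e4 : ε / (μ.mass + ν.mass + 1) * μ.mass + ε / (μ.mass + ν.mass + 1) * ν.mass ≤ ε := by
    rw [← mul_add, div_mul_eq_mul_div, div_le_iff₀ hM]
    nlinarith
  exact abs_le.2 ⟨by linarith, by linarith⟩

theorem isDivergence (hd : IsDualDistance b W₁ W₂ d) (hb : 0 < b)
    (hc₁ : Continuous W₁) (hc₂ : Continuous W₂) (h₁ : ∀ x, 0 < W₁ x) (h₂ : ∀ x, 0 < W₂ x) :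
    IsDivergence d :=
  ⟨hd.nonneg h₁ h₂, fun _ _ => ⟨hd.eq_of_eq_zero hb hc₁ hc₂ h₁ h₂, by
    rintro rfl
    exact hd.self_eq_zero h₁ h₂ _⟩⟩

/-- Along a Cauchy sequence all integrals of continuous functions converge. -/
theorem exists_tendsto_integral (hd : IsDualDistance b W₁ W₂ d) (hb : 0 < b)
    (hc₁ : Continuous W₁) (hc₂ : Continuous W₂) (h₁ : ∀ x, 0 < W₁ x) (h₂ : ∀ x, 0 < W₂ x)
    {u : ℕ → FiniteMeasure X} (hu : ∀ ε > 0, ∃ N, ∀ m ≥ N, ∀ n ≥ N, d (u m) (u n) < ε)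
    (f : C(X, ℝ)) :
    ∃ l, Filter.Tendsto (fun n => ∫ x, f x ∂(u n : Measure X)) Filter.atTop (nhds l) := by
  have hlip : ∀ g : C(X, ℝ), (∃ K, LipschitzWith K g) →
      CauchySeq fun n => ∫ x, g x ∂(u n : Measure X) := by
    rintro g ⟨K, hg⟩
    obtain ⟨C, hC0, hC⟩ := hd.exists_abs_sub_le hb hc₁ hc₂ h₁ h₂ g hg
    refine Metric.cauchySeq_iff.2 fun ε hε => ?_
    obtain ⟨N, hN⟩ := hu (ε / C) (div_pos hε hC0)
    refine ⟨N, fun m hm n hn => (hC _ _).trans_lt ?_⟩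
    rw [mul_comm]
    exact (lt_div_iff₀ hC0).1 (hN m hm n hn)
  -- The constant 1 is Lipschitz, so its integrals, the masses, stay bounded; this makes uniform
  -- approximation effective along the whole sequence.
  obtain ⟨M, hM⟩ : ∃ M, ∀ n, ((u n).mass : ℝ) ≤ M := by
    have h1 : CauchySeq _ := hlip 1 ⟨0, LipschitzWith.const 1⟩
    obtain ⟨M, hM⟩ := h1.isBounded_range.bddAbove
    refine ⟨M, fun n => ?_⟩
    have := hM ⟨n, rfl⟩
    have h1 : ((u n : Measure X) Set.univ).toReal ≤ M := by simpa [Measure.real] using this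
    exact h1
  have hM0 : 0 ≤ M := (u 0).mass.coe_nonneg.trans (hM 0)
  refine cauchySeq_tendsto_of_complete (Metric.cauchySeq_iff.2 fun ε hε => ?_)
  obtain ⟨g, hg, hfg⟩ := f.exists_lipschitz_approx (ε := ε / (4 * (M + 1))) (by positivity)
  obtain ⟨N, hN⟩ := Metric.cauchySeq_iff.1 (hlip g hg) (ε / 2) (half_pos hε)
  refine ⟨N, fun m hm n hn => ?_⟩
  have e0 := abs_lt.1 (hN m hm n hn)
  have e4 : ∀ n, ε / (4 * (M + 1)) * (u n).mass ≤ ε / 4 := fun n => by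
    rw [div_mul_eq_mul_div, div_le_div_iff₀ (by positivity) (by positivity)]
    nlinarith [hM n]
  have e1 := abs_le.1 ((abs_integral_sub_le f g hfg (u m)).trans (e4 m))
  have e2 := abs_le.1 ((abs_integral_sub_le f g hfg (u n)).trans (e4 n))
  rw [Real.dist_eq]
  exact abs_lt.2 ⟨by linarith, by linarith⟩

/-- Riesz represents the limit functional. The Cauchy bound holds for each potential separately and
survives the passage to the limit, with ≤ in place of <. -/
theorem exists_limit (hd : IsDualDistance b W₁ W₂ d) (hb : 0 < b)
    (hc₁ : Continuous W₁) (hc₂ : Continuous W₂) (h₁ : ∀ x, 0 < W₁ x) (h₂ : ∀ x, 0 < W₂ x)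
    {u : ℕ → FiniteMeasure X} (hu : ∀ ε > 0, ∃ N, ∀ m ≥ N, ∀ n ≥ N, d (u m) (u n) < ε) :
    ∃ μ, ∀ ε > 0, ∃ N, ∀ n ≥ N, d (u n) μ ≤ ε := by
  choose l hl using hd.exists_tendsto_integral hb hc₁ hc₂ h₁ h₂ hu
  let ℓ : C(X, ℝ) →ₗ[ℝ] ℝ :=
    { toFun := l
      map_add' := fun f g => tendsto_nhds_unique (hl (f + g)) (by
        convert (hl f).add (hl g) using 2
        exact integral_add (f.integrable_of_compactSpace _) (g.integrable_of_compactSpace _))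
      map_smul' := fun c f => tendsto_nhds_unique (hl (c • f)) (by
        simpa [integral_const_mul] using (hl f).const_mul c) }
  obtain ⟨μ, hμ⟩ := exists_finiteMeasure_integral_eq ℓ fun f hf =>
    ge_of_tendsto' (hl f) fun n => integral_nonneg hf
  refine ⟨μ, fun ε hε => ?_⟩
  obtain ⟨N, hN⟩ := hu ε hε
  refine ⟨N, fun n hn => hd.le fun f hf => ?_⟩
  have ht : Filter.Tendsto (fun m => ∫ x, f x ∂(u n : Measure X) - ∫ x, f x ∂(u m : Measure X))
      Filter.atTop (nhds (∫ x, f x ∂(u n : Measure X) - ∫ x, f x ∂(μ : Measure X))) := by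
    have h1 : ∫ x, f x ∂(μ : Measure X) = l ⟨f, hf.1.continuous⟩ := hμ ⟨f, hf.1.continuous⟩
    rw [h1]
    exact (hl ⟨f, hf.1.continuous⟩).const_sub _
  refine le_of_tendsto ht (Filter.eventually_atTop.2 ⟨N, fun m hm => ?_⟩)
  exact (hd.sub_le hf _ _).trans (hN n hn m hm).le

theorem isCompleteMetric (hd : IsDualDistance b W₁ W₁ d) (hb : 0 < b)
    (hc : Continuous W₁) (h : ∀ x, 0 < W₁ x) : IsCompleteMetric d := by
  let m : MetricSpace (FiniteMeasure X) :=
    { dist := d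
      dist_self := hd.self_eq_zero h h
      dist_comm := hd.symm
      dist_triangle := fun μ σ ν => hd.triangle μ ν σ
      eq_of_dist_eq_zero := hd.eq_of_eq_zero hb hc hc h h }
  refine ⟨m, fun _ _ => rfl, ?_⟩
  refine @Metric.complete_of_cauchySeq_tendsto _ m.toPseudoMetricSpace fun u hu => ?_
  obtain ⟨μ, hμ⟩ := hd.exists_limit hb hc hc h h 
    ((@Metric.cauchySeq_iff _ _ m.toPseudoMetricSpace _ _ _).1 hu)
  refine ⟨μ, (@Metric.tendsto_atTop _ _ m.toPseudoMetricSpace _ _ _ _).2 fun ε hε => ?_⟩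
  obtain ⟨N, hN⟩ := hμ (ε / 2) (half_pos hε)
  exact ⟨N, fun n hn => (hN n hn).trans_lt (half_lt_self hε)⟩

/-- If the points of the base space are joined by a measurable family of geodesics, then the
measures are joined by geodesics. -/
theorem isGeodesic (hd : IsDualDistance b W₁ W₁ d) (hb : 0 < b)
    (hc : Continuous W₁) (h : ∀ x, 0 < W₁ x)
    (hplan : ∀ μ ν : FiniteMeasure X, ∃ γ ∈ subPlans μ ν, d μ ν =
      ∫ x, W₁ x ∂(μ : Measure X) + ∫ x, W₁ x ∂(ν : Measure X)
        + ∫ z, (b * dist z.1 z.2 - W₁ z.1 - W₁ z.2) ∂(γ : Measure (X × X)))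
    (e : ℝ → X × X → X) (hem : ∀ t ∈ Set.Icc (0 : ℝ) 1, Measurable (e t)) (he0 : ∀ z, e 0 z = z.1)
    (he1 : ∀ z, e 1 z = z.2) (he : ∀ s ∈ Set.Icc (0 : ℝ) 1, ∀ t ∈ Set.Icc (0 : ℝ) 1, ∀ z,
      dist (e s z) (e t z) ≤ |s - t| * dist z.1 z.2) : IsGeodesic d := by
  intro μ ν
  obtain ⟨γ, hγ, hD⟩ := hplan μ ν
  obtain ⟨α, hα⟩ : ∃ α : FiniteMeasure X, μ = α + γ.map Prod.fst := by
    refine ⟨⟨(μ : Measure X) - (γ : Measure (X × X)).map Prod.fst, inferInstance⟩, Subtype.ext ?_⟩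
    exact (Measure.sub_add_cancel_of_le hγ.1).symm
  obtain ⟨β, hβ⟩ : ∃ β : FiniteMeasure X, ν = β + γ.map Prod.snd := by
    refine ⟨⟨(ν : Measure X) - (γ : Measure (X × X)).map Prod.snd, inferInstance⟩, Subtype.ext ?_⟩
    exact (Measure.sub_add_cancel_of_le hγ.2).symm
  have hmap {f : X → ℝ} (hf : Continuous f) {p : X × X → X} (hp : Measurable p) :
      ∫ x, f x ∂(γ.map p : Measure X) = ∫ z, f (p z) ∂(γ : Measure (X × X)) := by
    rw [FiniteMeasure.toMeasure_map]
    exact integral_map hp.aemeasurable hf.aestronglyMeasurable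
  have hadd {f : X → ℝ} (hf : Continuous f) (m m' : FiniteMeasure X) :
      ∫ x, f x ∂((m + m' : FiniteMeasure X) : Measure X) =
        ∫ x, f x ∂(m : Measure X) + ∫ x, f x ∂(m' : Measure X) := by
    rw [FiniteMeasure.toMeasure_add]
    exact integral_add_measure (hf.integrable_of_compactSpace _) (hf.integrable_of_compactSpace _)
  have hD' : d μ ν = ∫ x, W₁ x ∂(α : Measure X) + ∫ x, W₁ x ∂(β : Measure X)
      + b * ∫ z, dist z.1 z.2 ∂(γ : Measure (X × X)) := by
    have i1 : Integrable (fun z : X × X => W₁ z.1) (γ : Measure (X × X)) :=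
      (hc.comp continuous_fst).integrable_of_compactSpace _
    have i2 : Integrable (fun z : X × X => W₁ z.2) (γ : Measure (X × X)) :=
      (hc.comp continuous_snd).integrable_of_compactSpace _
    have i3 : Integrable (fun z : X × X => b * dist z.1 z.2) (γ : Measure (X × X)) :=
      (continuous_dist.integrable_of_compactSpace _).const_mul _
    rw [hD, integral_sub (i3.sub' i1) i2, integral_sub i3 i1, integral_const_mul]
    nth_rw 1 [hα, hβ]
    rw [hadd hc, hadd hc, hmap hc measurable_fst, hmap hc measurable_snd]
    ring
  -- Untransported mass is faded out of α and into β, while transported mass moves along geodesics.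
  let ψ : ℝ → FiniteMeasure X := fun t =>
    (1 - t).toNNReal • α + t.toNNReal • β + γ.map (e t)
  have hψ0 : ψ 0 = μ := by
    have : e 0 = Prod.fst := funext he0
    simp [ψ, this, ← hα]
  have hψ1 : ψ 1 = ν := by
    have : e 1 = Prod.snd := funext he1
    simp [ψ, this, ← hβ]
  have hψf {f : X → ℝ} (hf : Continuous f) {t : ℝ} (ht : t ∈ Set.Icc (0 : ℝ) 1) :
      ∫ x, f x ∂(ψ t : Measure X) = (1 - t) * ∫ x, f x ∂(α : Measure X)
        + t * ∫ x, f x ∂(β : Measure X) + ∫ z, f (e t z) ∂(γ : Measure (X × X)) := by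
    have hs (c : ℝ) (hc : 0 ≤ c) (m : FiniteMeasure X) :
        ∫ x, f x ∂((c.toNNReal • m : FiniteMeasure X) : Measure X) =
          c * ∫ x, f x ∂(m : Measure X) := by
      rw [FiniteMeasure.toMeasure_smul, integral_smul_nnreal_measure, NNReal.smul_def,
        Real.coe_toNNReal _ hc, smul_eq_mul]
    rw [hadd hf, hadd hf, hs _ (sub_nonneg.2 ht.2), hs _ ht.1, hmap hf (hem t ht)]
  have hle : ∀ s ∈ Set.Icc (0 : ℝ) 1, ∀ t ∈ Set.Icc (0 : ℝ) 1, d (ψ s) (ψ t) ≤ |s - t| * d μ ν := by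
    intro s hs t ht
    refine hd.le fun f hf => ?_
    have hfc := hf.1.continuous
    have hint (t : ℝ) (ht : t ∈ Set.Icc (0 : ℝ) 1) :
        Integrable (fun z => f (e t z)) (γ : Measure (X × X)) := by
      obtain ⟨C, hC⟩ := isCompact_univ.exists_bound_of_continuousOn hfc.continuousOn
      exact Integrable.of_bound (hfc.measurable.comp (hem t ht)).aestronglyMeasurable C
        (Filter.Eventually.of_forall fun z => hC _ (Set.mem_univ _))
    have e1 : ∫ z, f (e s z) ∂(γ : Measure (X × X)) - ∫ z, f (e t z) ∂(γ : Measure (X × X)) ≤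
        |s - t| * (b * ∫ z, dist z.1 z.2 ∂(γ : Measure (X × X))) := by
      rw [← integral_sub (hint s hs) (hint t ht), ← integral_const_mul, ← integral_const_mul]
      refine integral_mono ((hint s hs).sub (hint t ht))
        (Continuous.integrable_of_compactSpace (by fun_prop) _) fun z => ?_
      have h1 := hf.1.dist_le_mul (e s z) (e t z)
      rw [Real.dist_eq] at h1
      have h2 := mul_le_mul_of_nonneg_left (he s hs t ht z) b.coe_nonneg
      have h3 := le_abs_self (f (e s z) - f (e t z))
      simp only
      linarith
    -- Equal weights make the constraint on f symmetric, |f| ≤ W₁, so fading costs at most the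
    -- entropy part of `hD'`.
    have hb1 (m : FiniteMeasure X) :
        |∫ x, f x ∂(m : Measure X)| ≤ ∫ x, W₁ x ∂(m : Measure X) := by
      refine (abs_integral_le_integral_abs).trans (integral_mono
        (hfc.abs.integrable_of_compactSpace _) (hc.integrable_of_compactSpace _) fun x => ?_)
      exact abs_le.2 ⟨(hf.2 x).2, (hf.2 x).1⟩
    have e2 : (t - s) * (∫ x, f x ∂(α : Measure X) - ∫ x, f x ∂(β : Measure X)) ≤
        |s - t| * (∫ x, W₁ x ∂(α : Measure X) + ∫ x, W₁ x ∂(β : Measure X)) := by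
      refine (le_abs_self _).trans ?_
      rw [abs_mul, abs_sub_comm t s]
      gcongr
      exact (abs_sub _ _).trans (add_le_add (hb1 α) (hb1 β))
    rw [hψf hfc hs, hψf hfc ht, hD']
    linarith
  -- The bounds on [0, s], [s, t] and [t, 1] add up to d(μ,ν), so by the triangle inequality none of
  -- them is strict.
  have hle' : ∀ s ∈ Set.Icc (0 : ℝ) 1, ∀ t ∈ Set.Icc (0 : ℝ) 1, s ≤ t →
      d (ψ s) (ψ t) = (t - s) * d μ ν := by
    intro s hs t ht hst
    have h0 : (0 : ℝ) ∈ Set.Icc (0 : ℝ) 1 := by simp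
    have h1 : (1 : ℝ) ∈ Set.Icc (0 : ℝ) 1 := by simp
    have e1 := hle 0 h0 s hs
    have e2 := hle s hs t ht
    have e3 := hle t ht 1 h1
    rw [abs_sub_comm, abs_of_nonneg (by linarith)] at e2
    rw [abs_sub_comm, sub_zero, abs_of_nonneg hs.1, hψ0] at e1
    rw [abs_sub_comm, abs_of_nonneg (sub_nonneg.2 ht.2), hψ1] at e3
    have e4 := hd.triangle μ ν (ψ s)
    have e5 := hd.triangle (ψ s) ν (ψ t)
    linarith
  have hdiv := hd.isDivergence hb hc hc h h
  -- If d(μ,ν) = 0, the quotient is 0 by convention and the path is constantly μ = ν.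
  refine ⟨fun r => ψ (r / d μ ν), by simp [hψ0], ?_, fun t ht s hs => ?_⟩
  · rcases eq_or_ne (d μ ν) 0 with h0 | h0
    · simpa [h0, hψ0] using (hdiv.2 _ _).1 h0
    · simp [div_self h0, hψ1]
  · rcases (hdiv.1 μ ν).eq_or_lt with h0 | h0
    · rw [← h0, Set.Icc_self] at ht hs
      rw [ht, hs]
      simpa using hd.self_eq_zero h h _
    · have hu : ∀ t ∈ Set.Icc 0 (d μ ν), t / d μ ν ∈ Set.Icc (0 : ℝ) 1 := fun t ht =>
        ⟨div_nonneg ht.1 h0.le, (div_le_one h0).2 ht.2⟩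
      rcases le_total s t with hst | hst
      · rw [hd.symm, hle' _ (hu s hs) _ (hu t ht) (by gcongr), abs_of_nonneg (by linarith),
          ← sub_div, div_mul_cancel₀ _ h0.ne']
      · rw [hle' _ (hu t ht) _ (hu s hs) (by gcongr), abs_sub_comm, abs_of_nonneg (by linarith),
          ← sub_div, div_mul_cancel₀ _ h0.ne']

end IsDualDistance

end DualDistance

/-! ### Geodesics in compact metric spaces -/

section JoinedBy

variable {X : Type*} [MetricSpace X]

/-- There is a `1`-Lipschitz path from `x` to `y` parametrized by `[0, L]`. -/
def JoinedBy (x y : X) (L : ℝ) : Prop :=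
  0 ≤ L ∧ ∃ g : ℝ → X, LipschitzWith 1 g ∧ g 0 = x ∧ g L = y

theorem JoinedBy.refl (x : X) : JoinedBy x x 0 :=
  ⟨le_rfl, fun _ => x, LipschitzWith.const' x, rfl, rfl⟩

theorem JoinedBy.trans {x y z : X} {L L' : ℝ} (h : JoinedBy x y L) (h' : JoinedBy y z L') :
    JoinedBy x z (L + L') := by
  obtain ⟨hL, g, hg, h0, h1⟩ := h
  obtain ⟨hL', g', hg', h0', h1'⟩ := h'
  refine ⟨add_nonneg hL hL', fun s => if s ≤ L then g s else g' (s - L), ?_, by simp [hL, h0], ?_⟩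
  · have key : ∀ s t : ℝ, s ≤ t → dist (if s ≤ L then g s else g' (s - L))
        (if t ≤ L then g t else g' (t - L)) ≤ dist s t := fun s t hst => by
      have e1 := fun s t => hg.dist_le_mul s t
      have e2 := fun s t => hg'.dist_le_mul s t
      simp only [NNReal.coe_one, one_mul] at e1 e2
      split_ifs with hs ht ht
      · exact e1 s t
      · refine (dist_triangle _ y _).trans ?_
        have h2 := e1 s L
        have h3 := e2 0 (t - L)
        rw [h1] at h2
        rw [h0'] at h3
        rw [Real.dist_eq, abs_of_nonpos (by linarith)] at h2 h3 ⊢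
        linarith
      · linarith
      · simpa [Real.dist_eq] using e2 (s - L) (t - L)
    refine LipschitzWith.of_dist_le_mul fun s t => ?_
    rw [NNReal.coe_one, one_mul]
    rcases le_total s t with hst | hst
    · exact key s t hst
    · rw [dist_comm, dist_comm s]
      exact key t s hst
  -- When L' = 0 the end point falls in the first branch, which gives y; but then y = z.
  · rcases hL'.eq_or_lt with h | h
    · simp only [← h, add_zero, le_refl, if_true, h1]
      rw [← h0', ← h1', ← h]
    · simp [h.not_ge, h1']

/-- In a compact space any two points of which are joined by a geodesic, points of which are
determined by their distances to the end points, geodesics depend continuously on their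
end points. -/
theorem exists_continuous_geodesics [CompactSpace X]
    (hj : ∀ x y : X, JoinedBy x y (dist x y))
    (hu : ∀ x y z z' : X, dist x z = dist x z' → dist x z + dist z y = dist x y →
      dist x z' + dist z' y = dist x y → z = z') :
    ∃ e : ℝ → X × X → X, (∀ t ∈ Set.Icc (0 : ℝ) 1, Continuous (e t)) ∧ (∀ z, e 0 z = z.1) ∧
      (∀ z, e 1 z = z.2) ∧ ∀ s t z, dist (e s z) (e t z) ≤ |s - t| * dist z.1 z.2 := by
  choose g hg h0 h1 using fun z : X × X => (hj z.1 z.2).2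
  have hdist : ∀ s t z, dist (g z (s * dist z.1 z.2)) (g z (t * dist z.1 z.2)) ≤
      |s - t| * dist z.1 z.2 := fun s t z => by
    refine ((hg z).dist_le_mul _ _).trans_eq ?_
    rw [NNReal.coe_one, one_mul, Real.dist_eq, ← sub_mul, abs_mul, abs_of_nonneg dist_nonneg]
  refine ⟨fun t z => g z (t * dist z.1 z.2), fun t ht => ?_, fun z => by simp [h0],
    fun z => by simp [h1], hdist⟩
  have hval : ∀ z, dist z.1 (g z (t * dist z.1 z.2)) = t * dist z.1 z.2 ∧
      dist (g z (t * dist z.1 z.2)) z.2 = (1 - t) * dist z.1 z.2 := fun z => by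
    have e1 := hdist 0 t z
    have e2 := hdist t 1 z
    rw [zero_mul, h0, zero_sub, abs_neg, abs_of_nonneg ht.1] at e1
    rw [one_mul, h1, abs_sub_comm, abs_of_nonneg (sub_nonneg.2 ht.2)] at e2
    have e3 := dist_triangle z.1 (g z (t * dist z.1 z.2)) z.2
    exact ⟨by linarith, by linarith⟩
  refine continuous_iff_isClosed.2 fun C hC => ?_
  -- By uniqueness e_t(z) is the only point with these two distances, so the preimage of C is the
  -- projection of this closed set along the compact factor X, hence closed.
  have hS : IsClosed {q : (X × X) × X | dist q.1.1 q.2 = t * dist q.1.1 q.1.2 ∧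
      dist q.2 q.1.2 = (1 - t) * dist q.1.1 q.1.2 ∧ q.2 ∈ C} :=
    (isClosed_eq (by fun_prop) (by fun_prop)).inter
      ((isClosed_eq (by fun_prop) (by fun_prop)).inter (hC.preimage continuous_snd))
  convert isClosedMap_fst_of_compactSpace _ hS using 1
  ext z
  constructor
  · exact fun hz => ⟨(z, _), ⟨(hval z).1, (hval z).2, hz⟩, rfl⟩
  · rintro ⟨⟨z', p⟩, ⟨hp1, hp2, hp⟩, rfl⟩
    simp only at hp1 hp2 hp
    have := hu z'.1 z'.2 p (g z' (t * dist z'.1 z'.2)) (by rw [hp1, (hval z').1])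
      (by rw [hp1, hp2]; ring) (by rw [(hval z').1, (hval z').2]; ring)
    simp only [Set.mem_preimage]
    rwa [← this]

end JoinedBy

/-! ### Geometry of the tree -/

namespace WeightedTree

variable {V : Type*} [Fintype V] [DecidableEq V] (𝒯 : WeightedTree V)

theorem isCompact_carrier : IsCompact 𝒯.carrier := by
  have h : 𝒯.carrier = Set.range 𝒯.node ∪
      ⋃ p ∈ {p : V × V | 𝒯.graph.Adj p.1 p.2}, segment ℝ (𝒯.node p.1) (𝒯.node p.2) := by
    ext x
    simp [carrier, eq_comm]
  rw [h]
  refine (Set.finite_range _).isCompact.union ((Set.toFinite _).isCompact_biUnion fun p _ => ?_)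
  rw [segment_eq_image_lineMap]
  exact isCompact_Icc.image AffineMap.lineMap_continuous

instance : CompactSpace 𝒯.Point := isCompact_iff_compactSpace.1 𝒯.isCompact_carrier

theorem mem_edges_of_node_ne {u v : V} {e : Sym2 V} (h : 𝒯.node u e ≠ 𝒯.node v e) :
    e ∈ (𝒯.path u v).edges := by
  by_contra he
  have := 𝒯.node_path _ (𝒯.path_isPath u v) e
  rw [if_neg he, abs_eq_zero, sub_eq_zero] at this
  exact h this

/-- Suppose both equalities fail. Then the edge u'v' lies on the path from z to u, and both its ends
are separated from z by the edge uv. But that path can cross uv only on arriving at u, so u' = u =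
v', which is absurd. -/
theorem node_eq_or_node_eq {u v u' v' : V} (h' : 𝒯.graph.Adj u' v')
    (hne : s(u, v) ≠ s(u', v')) (z : V) :
    𝒯.node z s(u, v) = 𝒯.node u' s(u, v) ∨ 𝒯.node z s(u', v') = 𝒯.node u s(u', v') := by
  by_contra! hz
  have huv' : 𝒯.node u' s(u, v) = 𝒯.node v' s(u, v) := by
    have := 𝒯.node_adj h' s(u, v)
    rwa [if_neg hne, abs_eq_zero, sub_eq_zero] at this
  have hf := 𝒯.mem_edges_of_node_ne hz.2
  have key : ∀ w ∈ (𝒯.path z u).support, 𝒯.node z s(u, v) ≠ 𝒯.node w s(u, v) → w = u := by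
    intro w hw hzw
    by_contra hwu
    have he := 𝒯.mem_edges_of_node_ne hzw
    rw [← 𝒯.eq_path _ ((𝒯.path_isPath z u).takeUntil hw)] at he
    exact SimpleGraph.Walk.endpoint_notMem_support_takeUntil (𝒯.path_isPath z u) hw
      (Ne.symm hwu)
      (SimpleGraph.Walk.fst_mem_support_of_mem_edges _ he)
  have e1 := key u' (SimpleGraph.Walk.fst_mem_support_of_mem_edges _ hf) hz.1
  have e2 := key v' (SimpleGraph.Walk.snd_mem_support_of_mem_edges _ hf) (huv' ▸ hz.1)
  exact h'.ne (e1.trans e2.symm)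

theorem apply_eq_zero_of_notMem_edgeSet {e : Sym2 V} (he : e ∉ 𝒯.graph.edgeSet)
    {x : PiLp 1 (fun _ : Sym2 V => ℝ)} (hx : x ∈ 𝒯.carrier) : x e = 0 := by
  have hn : ∀ v, 𝒯.node v e = 0 := fun v =>
    if_neg fun h => he (SimpleGraph.Walk.edges_subset_edgeSet _ h)
  rcases hx with ⟨v, rfl⟩ | ⟨u, v, -, p, q, -, -, -, rfl⟩
  · exact hn v
  · simp [hn]

/-- Two different edges separate the tree into at most three parts. -/
theorem exists_apply_eq_or {e f : Sym2 V} (hef : e ≠ f) :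
    ∃ α β : ℝ, ∀ x ∈ 𝒯.carrier, x e = α ∨ x f = β := by
  by_cases he : e ∈ 𝒯.graph.edgeSet
  swap
  · exact ⟨0, 0, fun x hx => Or.inl (𝒯.apply_eq_zero_of_notMem_edgeSet he hx)⟩
  by_cases hf : f ∈ 𝒯.graph.edgeSet
  swap
  · exact ⟨0, 0, fun x hx => Or.inr (𝒯.apply_eq_zero_of_notMem_edgeSet hf hx)⟩
  induction e with | h u v
  induction f with | h u' v'
  rw [SimpleGraph.mem_edgeSet] at he hf
  refine ⟨𝒯.node u' s(u, v), 𝒯.node u s(u', v'), fun x hx => ?_⟩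
  rcases hx with ⟨z, rfl⟩ | ⟨p, q, hpq, hx⟩
  · exact 𝒯.node_eq_or_node_eq hf hef z
  · by_cases h1 : s(u', v') = s(p, q)
    · exact Or.inl (𝒯.node_eq_off hpq (h1 ▸ hef) hx (h1 ▸ Sym2.mem_mk_left u' v'))
    · by_cases h2 : s(u, v) = s(p, q)
      · exact Or.inr (𝒯.node_eq_off hpq h1 hx (h2 ▸ Sym2.mem_mk_left u v))
      · rw [𝒯.node_eq_off hpq h1 hx (Sym2.mem_mk_left p q),
          𝒯.node_eq_off hpq h2 hx (Sym2.mem_mk_left p q)]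
        exact 𝒯.node_eq_or_node_eq hf hef p

theorem abs_sub_add_abs_sub_eq {x y z : PiLp 1 (fun _ : Sym2 V => ℝ)}
    (h : dist x z + dist z y = dist x y) (e : Sym2 V) :
    |x e - z e| + |z e - y e| = |x e - y e| := by
  simp only [dist_eq_sum, ← Finset.sum_add_distrib] at h
  exact ((Finset.sum_eq_sum_iff_of_le fun e _ => abs_sub_le (x e) (z e) (y e)).1 h.symm e
    (Finset.mem_univ e)).symm

theorem ne_of_between {x y z z' : ℝ} (h : |x - z| + |z - y| = |x - y|)
    (h' : |x - z'| + |z' - y| = |x - y|) (hlt : |x - z| < |x - z'|) :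
    z ≠ z' ∧ z ≠ y ∧ z' ≠ x := by
  refine ⟨?_, ?_, ?_⟩
  · rintro rfl
    exact hlt.false
  · rintro rfl
    linarith [abs_nonneg (z' - z)]
  · rintro rfl
    rw [sub_self, abs_zero] at hlt
    exact (abs_nonneg _).not_gt hlt

theorem eq_of_between {x y z z' : ℝ} (h : |x - z| + |z - y| = |x - y|)
    (h' : |x - z'| + |z' - y| = |x - y|) (heq : |x - z| = |x - z'|) : z = z' := by
  grind

/-- A point on a path is determined by its distances to the end points. -/
theorem eq_of_dist_eq {x y z z' : PiLp 1 (fun _ : Sym2 V => ℝ)} (hx : x ∈ 𝒯.carrier)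
    (hy : y ∈ 𝒯.carrier) (hz : z ∈ 𝒯.carrier) (hz' : z' ∈ 𝒯.carrier)
    (hd : dist x z = dist x z') (h : dist x z + dist z y = dist x y)
    (h' : dist x z' + dist z' y = dist x y) : z = z' := by
  have hc := abs_sub_add_abs_sub_eq h
  have hc' := abs_sub_add_abs_sub_eq h'
  by_contra hne
  -- Equal total distances with different coordinates force one edge e where z' is farther from x
  -- than z, and another edge f where it is nearer.
  obtain ⟨e₀, he₀⟩ : ∃ e, |x e - z' e| - |x e - z e| ≠ 0 := by
    by_contra! hall
    refine hne (PiLp.ext fun e => ?_)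
    exact eq_of_between (hc e) (hc' e) (sub_eq_zero.1 (hall e)).symm
  have hsum : ∑ e, (|x e - z' e| - |x e - z e|) = 0 := by
    rw [Finset.sum_sub_distrib, ← dist_eq_sum, ← dist_eq_sum, hd, sub_self]
  obtain ⟨e, -, he⟩ := Finset.exists_pos_of_sum_zero_of_exists_nonzero _ hsum
    ⟨e₀, Finset.mem_univ _, he₀⟩
  obtain ⟨f, -, hf⟩ := Finset.exists_pos_of_sum_zero_of_exists_nonzero
    (fun e => -(|x e - z' e| - |x e - z e|)) (by rw [Finset.sum_neg_distrib, hsum, neg_zero])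
    ⟨e₀, Finset.mem_univ _, neg_ne_zero.2 he₀⟩
  have hef : e ≠ f := by
    rintro rfl
    linarith
  -- In coordinates (e, f) the tree lies in a cross. If z e = α, then z' and y are off that line, so
  -- z' f = β = y f, against `b2`. Otherwise z f = β, so z' and x are off that line and z' e = α = x
  -- e, against `a3`.
  obtain ⟨α, β, hαβ⟩ := 𝒯.exists_apply_eq_or hef
  obtain ⟨a1, a2, a3⟩ := ne_of_between (hc e) (hc' e) (by linarith)
  obtain ⟨b1, b2, b3⟩ := ne_of_between (hc' f) (hc f) (by linarith)
  have := hαβ x hx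
  have := hαβ y hy
  have := hαβ z hz
  have := hαβ z' hz'
  grind

theorem segment_subset_carrier {u v : V} (h : 𝒯.graph.Adj u v) :
    segment ℝ (𝒯.node u) (𝒯.node v) ⊆ 𝒯.carrier := fun _ hx => Or.inr ⟨u, v, h, hx⟩

/-- A node, as a point of the tree. -/
def nodePoint (v : V) : 𝒯.Point := ⟨𝒯.node v, Or.inl ⟨v, rfl⟩⟩

theorem joinedBy_of_mem_segment {u v : V} (h : 𝒯.graph.Adj u v) {x y : 𝒯.Point}
    (hx : x.1 ∈ segment ℝ (𝒯.node u) (𝒯.node v)) (hy : y.1 ∈ segment ℝ (𝒯.node u) (𝒯.node v)) :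
    JoinedBy x y (dist x y) := by
  rcases eq_or_ne x y with rfl | hxy
  · rw [dist_self]
    exact JoinedBy.refl x
  have hD : 0 < dist x y := dist_pos.2 hxy
  have hmem : ∀ c ∈ Set.Icc (0 : ℝ) 1, AffineMap.lineMap x.1 y.1 c ∈ 𝒯.carrier := fun c hc =>
    𝒯.segment_subset_carrier h ((convex_segment _ _).lineMap_mem hx hy hc)
  -- Clamping the parameter to [0, 1] defines the path on all of ℝ without leaving the edge.
  refine ⟨hD.le, fun s => ⟨_, hmem _ (Set.projIcc (0 : ℝ) 1 zero_le_one (s / dist x y)).2⟩,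
    LipschitzWith.of_dist_le_mul fun s t => ?_, ?_, ?_⟩
  · have h1 := (LipschitzWith.projIcc (zero_le_one (α := ℝ))).dist_le_mul
      (s / dist x y) (t / dist x y)
    rw [NNReal.coe_one, one_mul] at h1 ⊢
    rw [Subtype.dist_eq, dist_lineMap_lineMap]
    refine (mul_le_mul_of_nonneg_right h1 dist_nonneg).trans_eq ?_
    rw [Real.dist_eq, Real.dist_eq, ← sub_div, abs_div, abs_of_pos hD]
    exact div_mul_cancel₀ _ hD.ne'
  · simp [Set.projIcc_left]
  · simp [div_self hD.ne', Set.projIcc_right]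

theorem joinedBy_of_walk {u v : V} (p : 𝒯.graph.Walk u v) :
    JoinedBy (𝒯.nodePoint u) (𝒯.nodePoint v) (p.edges.map fun e => (𝒯.length e : ℝ)).sum := by
  induction p with
  | nil => simpa using JoinedBy.refl _
  | @cons u w v h p ih =>
    have h1 := 𝒯.joinedBy_of_mem_segment h (x := 𝒯.nodePoint u) (y := 𝒯.nodePoint w)
      (left_mem_segment ℝ _ _) (right_mem_segment ℝ _ _)
    have h2 : dist (𝒯.nodePoint u) (𝒯.nodePoint w) = 𝒯.length s(u, w) := by
      change dist (𝒯.node u) (𝒯.node w) = _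
      simpa using 𝒯.dist_edge h 0 1
    rw [h2] at h1
    simpa using h1.trans ih

theorem joinedBy_node (u v : V) :
    JoinedBy (𝒯.nodePoint u) (𝒯.nodePoint v) (dist (𝒯.nodePoint u) (𝒯.nodePoint v)) := by
  have := 𝒯.joinedBy_of_walk (𝒯.path u v)
  rwa [← 𝒯.dist_node] at this

/-- The given edge rules out the one-node tree; in any other tree each node is the end of some edge,
so nodes need no separate treatment. -/
theorem exists_mem_segment {u v : V} (h : 𝒯.graph.Adj u v)
    {x : PiLp 1 (fun _ : Sym2 V => ℝ)} (hx : x ∈ 𝒯.carrier) :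
    ∃ u v, 𝒯.graph.Adj u v ∧ x ∈ segment ℝ (𝒯.node u) (𝒯.node v) := by
  rcases hx with ⟨a, rfl⟩ | hx
  · have : Nontrivial V := ⟨u, v, h.ne⟩
    obtain ⟨c, hc⟩ := 𝒯.isTree.connected.preconnected.exists_adj_of_nontrivial a
    exact ⟨a, c, hc, left_mem_segment ℝ _ _⟩
  · exact hx

theorem node_mem_segment {u v a : V} (ha : a ∈ s(u, v)) :
    𝒯.node a ∈ segment ℝ (𝒯.node u) (𝒯.node v) := by
  rcases Sym2.mem_iff.1 ha with rfl | rfl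
  · exact left_mem_segment ℝ _ _
  · exact right_mem_segment ℝ _ _

theorem joinedBy_of_adj {u v u' v' : V} (h : 𝒯.graph.Adj u v) (h' : 𝒯.graph.Adj u' v')
    {x y : 𝒯.Point} (hx : x.1 ∈ segment ℝ (𝒯.node u) (𝒯.node v))
    (hy : y.1 ∈ segment ℝ (𝒯.node u') (𝒯.node v')) : JoinedBy x y (dist x y) := by
  by_cases hne : s(u, v) = s(u', v')
  · refine 𝒯.joinedBy_of_mem_segment h hx ?_
    rcases Sym2.eq_iff.1 hne with ⟨rfl, rfl⟩ | ⟨rfl, rfl⟩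
    · exact hy
    · rwa [segment_symm]
  · obtain ⟨a, ha, c, hc, hd⟩ := 𝒯.dist_gate h h' hne hx hy
    have := ((𝒯.joinedBy_of_mem_segment h (y := 𝒯.nodePoint a) hx (𝒯.node_mem_segment ha)).trans
      (𝒯.joinedBy_node a c)).trans
      (𝒯.joinedBy_of_mem_segment h' (x := 𝒯.nodePoint c) (𝒯.node_mem_segment hc) hy)
    rwa [Subtype.dist_eq x y, hd]

/-- Any two points of the tree are joined by a geodesic. -/
theorem joinedBy_dist (x y : 𝒯.Point) : JoinedBy x y (dist x y) := by
  obtain ⟨x, hx⟩ := x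
  obtain ⟨y, hy⟩ := y
  rcases id hx with ⟨a, rfl⟩ | ⟨u, v, h, hxs⟩
  · rcases id hy with ⟨c, rfl⟩ | ⟨u', v', h', hys⟩
    · exact 𝒯.joinedBy_node a c
    · obtain ⟨u, v, h, hxs⟩ := 𝒯.exists_mem_segment h' hx
      exact 𝒯.joinedBy_of_adj h h' hxs hys
  · obtain ⟨u', v', h', hys⟩ := 𝒯.exists_mem_segment h hy
    exact 𝒯.joinedBy_of_adj h h' hxs hys

end WeightedTree

end

theorem proposition3p7 {V : Type*} [Fintype V] [DecidableEq V] (𝒯 : WeightedTree V)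
    (b : ℝ≥0) (lam : ℝ) (hlam : 0 ≤ lam) (w₁ w₂ : 𝒯.Point → ℝ)
    (hw₁ : ∀ x, 0 < w₁ x) (hw₂ : ∀ x, 0 < w₂ x)
    (hL₁ : LipschitzWith b w₁) (hL₂ : LipschitzWith b w₂)
    (d : FiniteMeasure 𝒯.Point → FiniteMeasure 𝒯.Point → ℝ)
    (hd : d = entropyDist (b : ℝ) lam w₁ w₂) :
    (∀ μ ν σ, d (μ + σ) (ν + σ) = d μ ν) ∧
    (∀ μ ν σ, d μ ν ≤ d μ σ + d σ ν) ∧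
    (0 < b → IsDivergence d) ∧
    (0 < b → w₁ = w₂ → IsCompleteMetric d ∧ IsGeodesic d) := by
  subst hd
  have hdual := exists_entropyDist_eq hlam hw₁ hw₂ hL₁ hL₂ (fun _ => rfl) (fun _ => rfl)
  have hbl : 0 ≤ b * lam / 2 := by positivity
  have hD : IsDualDistance b (fun x => w₁ x + b * lam / 2) (fun x => w₂ x + b * lam / 2)
      (entropyDist (b : ℝ) lam w₁ w₂) := fun μ ν => (hdual μ ν).1
  have hc₁ : Continuous fun x => w₁ x + b * lam / 2 := hL₁.continuous.add continuous_const
  have hc₂ : Continuous fun x => w₂ x + b * lam / 2 := hL₂.continuous.add continuous_const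
  have hp₁ : ∀ x, 0 < w₁ x + b * lam / 2 := fun x => add_pos_of_pos_of_nonneg (hw₁ x) hbl
  have hp₂ : ∀ x, 0 < w₂ x + b * lam / 2 := fun x => add_pos_of_pos_of_nonneg (hw₂ x) hbl
  refine ⟨hD.add_right, hD.triangle, fun hb => hD.isDivergence hb hc₁ hc₂ hp₁ hp₂, ?_⟩
  rintro hb rfl
  obtain ⟨e, he, he0, he1, hdist⟩ := exists_continuous_geodesics 𝒯.joinedBy_dist
    fun x y z z' => fun h1 h2 h3 => Subtype.ext (𝒯.eq_of_dist_eq x.2 y.2 z.2 z'.2 h1 h2 h3)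
  exact ⟨hD.isCompleteMetric hb hc₁ hp₁, hD.isGeodesic hb hc₁ hp₁ (fun μ ν => (hdual μ ν).2) e
    (fun t ht => (he t ht).measurable) he0 he1 fun s _ t _ z => hdist s t z⟩
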